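/- Let $n\ge 1$, let $\Sigma$ be a compact smooth $n$-manifold without boundary, let $J\subseteq\mathbb R$ be an open interval, and let $X_s:\Sigma\to\mathbb R^{n+1}$, $s\in J$, be a family of smooth embeddings such that $(s,p)\mapsto X_s(p)$ is smooth on $J\times\Sigma$. Let $\nu_s$ be the outward unit normal of $X_s$ (on each connected component of the hypersurface it points from the bounded side of that component into its unbounded side). In local coordinates $u^1,\dots,u^n$ on $\Sigma$ write $$\sigma_{ij}=\Big\langle \frac{\partial X_s}{\partial u^i},\frac{\partial X_s}{\partial u^j}\Big\rangle,\qquad h_{ij}=\Big\langle \frac{\partial \nu_s}{\partial u^i},\frac{\partial X_s}{\partial u^j}\Big\rangle,\qquad H=\sigma^{ij}h_{ij},$$ for the induced metric, the second fundamental form and the mean curvature, where $(\sigma^{ij})$ is the inverse matrix of $(\sigma_{ij})$; let $dv_s=\sqrt{\det(\sigma_{ij})}\,du^1\cdots du^n$ be the induced volume measure and $\delta\sigma_{ij}=\frac{\partial}{\partial s}\sigma_{ij}$. (1) For every $s\in J$ the functions $H$ and $(H\sigma^{ij}-\sigma^{ik}\sigma^{jl}h_{kl})\,\delta\sigma_{ij}$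 are integrable with respect to $dv_s$, the total mean curvature $s\mapsto\int_\Sigma H\,dv_s$ is differentiable at $s$, and $$\frac{d}{ds}\int_\Sigma H\,dv_s=\frac12\int_\Sigma\big(H\sigma^{ij}-\sigma^{ik}\sigma^{jl}h_{kl}\big)\,\delta\sigma_{ij}\,dv_s .$$ (2) If moreover there is a smooth Riemannian metric $g$ on $\Sigma$ such that every $X_s$, $s\in J$, is an isometric embedding of $(\Sigma,g)$ into $\mathbb R^{n+1}$, then the total mean curvature $\int_\Sigma H\,dv_s$ does not depend on $s\in J$. -/

import Mathlib

open Set Filter Topology MeasureTheory Bornology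
open scoped Manifold ContDiff

noncomputable section

namespace Hypersurface

/-- Euclidean space `ℝ^(n+1)`. -/
abbrev Ambient (n : ℕ) : Type := EuclideanSpace ℝ (Fin (n + 1))

section Geometry

variable {n : ℕ} {M : Type*} [TopologicalSpace M] [ChartedSpace (EuclideanSpace ℝ (Fin n)) M]

/-- The coordinate derivative `∂F/∂uⁱ` of a map `F : M → ℝ^(n+1)`, at the coordinate point `u` of
the chart `(u¹, …, uⁿ)` attached to `x : M`. -/
def coordDeriv (F : M → Ambient n) (x : M) (u : EuclideanSpace ℝ (Fin n)) (i : Fin n) : Ambient n :=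
  fderiv ℝ (F ∘ (chartAt (EuclideanSpace ℝ (Fin n)) x).symm) u (EuclideanSpace.single i 1)

/-- The induced metric `σᵢⱼ = ⟨∂X/∂uⁱ, ∂X/∂uʲ⟩` in the chart attached to `x`. -/
def metricMatrix (X : M → Ambient n) (x : M) (u : EuclideanSpace ℝ (Fin n)) :
    Matrix (Fin n) (Fin n) ℝ :=
  Matrix.of fun i j ↦ inner ℝ (coordDeriv X x u i) (coordDeriv X x u j)

/-- The second fundamental form `hᵢⱼ = ⟨∂ν/∂uⁱ, ∂X/∂uʲ⟩` with respect to the unit normal `ν`, in the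
chart attached to `x`. -/
def sffMatrix (X ν : M → Ambient n) (x : M) (u : EuclideanSpace ℝ (Fin n)) :
    Matrix (Fin n) (Fin n) ℝ :=
  Matrix.of fun i j ↦ inner ℝ (coordDeriv ν x u i) (coordDeriv X x u j)

/-- The induced metric at the point `p`, in the chart attached to `p` itself. -/
def metricAt (X : M → Ambient n) (p : M) : Matrix (Fin n) (Fin n) ℝ :=
  metricMatrix X p (chartAt (EuclideanSpace ℝ (Fin n)) p p)

/-- The second fundamental form at the point `p`, in the chart attached to `p` itself. -/
def sffAt (X ν : M → Ambient n) (p : M) : Matrix (Fin n) (Fin n) ℝ :=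
  sffMatrix X ν p (chartAt (EuclideanSpace ℝ (Fin n)) p p)

/-- The mean curvature `H = σⁱʲ hᵢⱼ` with respect to the unit normal `ν`. -/
def meanCurvature (X ν : M → Ambient n) (p : M) : ℝ :=
  ∑ i, ∑ j, (metricAt X p)⁻¹ i j * sffAt X ν p i j

/-- The variation `δσᵢⱼ` at the parameter `s` of the induced metrics of the family `X`. -/
def metricVariation (X : ℝ → M → Ambient n) (s : ℝ) (p : M) : Matrix (Fin n) (Fin n) ℝ :=
  Matrix.of fun i j ↦ deriv (fun t ↦ metricAt (X t) p i j) s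

/-- The scalar `(H σⁱʲ - σⁱᵏ σʲˡ hₖₗ) δσᵢⱼ`, summed over all repeated indices. It does not depend
on the coordinates. -/
def variationDensity (X ν : ℝ → M → Ambient n) (s : ℝ) (p : M) : ℝ :=
  ∑ i, ∑ j, (meanCurvature (X s) (ν s) p * (metricAt (X s) p)⁻¹ i j
      - ∑ k, ∑ l, (metricAt (X s) p)⁻¹ i k * (metricAt (X s) p)⁻¹ j l * sffAt (X s) (ν s) p k l)
    * metricVariation X s p i j

/-- `ν` is the outward unit normal of the closed hypersurface `X`: it has length one, it is
orthogonal to the tangent spaces, and on each connected component `C` of the hypersurface it points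
from the bounded side of `C` into the unbounded side. (`connectedComponentIn Cᶜ y` is empty when
`y ∈ C`.) -/
structure IsOutwardUnitNormal (X ν : M → Ambient n) : Prop where
  norm_eq_one : ∀ p, ‖ν p‖ = 1
  orthogonal : ∀ (p : M) (v : TangentSpace (𝓡 n) p),
    inner (𝕜 := ℝ) (E := Ambient n) (ν p) (mfderiv (𝓡 n) 𝓘(ℝ, Ambient n) X p v) = 0
  outside : ∀ p, ∀ᶠ t : ℝ in 𝓝[>] 0,
    X p + t • ν p ∉ X '' connectedComponent p ∧
    ¬ IsBounded (connectedComponentIn (X '' connectedComponent p)ᶜ (X p + t • ν p))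
  inside : ∀ p, ∀ᶠ t : ℝ in 𝓝[>] 0,
    X p - t • ν p ∉ X '' connectedComponent p ∧
    IsBounded (connectedComponentIn (X '' connectedComponent p)ᶜ (X p - t • ν p))

/-- A smooth family of embeddings `X s : M → ℝ^(n+1)`, for `s ∈ J`: it is smooth in `(s, p)`, and
each `X s` is a smooth embedding. -/
structure IsSmoothFamilyOfEmbeddings (J : Set ℝ) (X : ℝ → M → Ambient n) : Prop where
  contMDiffOn : ContMDiffOn (𝓘(ℝ, ℝ).prod (𝓡 n)) 𝓘(ℝ, Ambient n) ∞
    (fun q : ℝ × M ↦ X q.1 q.2) (J ×ˢ univ)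
  isSmoothEmbedding : ∀ s ∈ J, Manifold.IsSmoothEmbedding (𝓡 n) 𝓘(ℝ, Ambient n) ∞ (X s)

/-- `X : (M, g) → ℝ^(n+1)` is isometric: the induced metric is `g`. -/
def IsIsometric [IsManifold (𝓡 n) ∞ M]
    (g : Bundle.ContMDiffRiemannianMetric (𝓡 n) ∞ (EuclideanSpace ℝ (Fin n))
      (fun p : M ↦ TangentSpace (𝓡 n) p))
    (X : M → Ambient n) : Prop :=
  ∀ (p : M) (v w : TangentSpace (𝓡 n) p),
    inner (𝕜 := ℝ) (E := Ambient n) (mfderiv (𝓡 n) 𝓘(ℝ, Ambient n) X p v)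
      (mfderiv (𝓡 n) 𝓘(ℝ, Ambient n) X p w) = g.inner p v w

end Geometry

section Volume

variable (n : ℕ) (M : Type*) [TopologicalSpace M] [ChartedSpace (EuclideanSpace ℝ (Fin n)) M]
  [IsManifold (𝓡 n) ∞ M] [T2Space M] [CompactSpace M]

/-- A smooth partition of unity of `M` subordinate to the cover by the domains of the charts. -/
def chartPartition : SmoothPartitionOfUnity M (𝓡 n) M univ :=
  (SmoothPartitionOfUnity.exists_isSubordinate_chartAt_source (𝓡 n) M).choose

/-- The partition of unity is subordinate to the chart domains. -/
theorem chartPartition_isSubordinate :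
    (chartPartition n M).IsSubordinate
      (fun x ↦ (chartAt (EuclideanSpace ℝ (Fin n)) x).source) :=
  (SmoothPartitionOfUnity.exists_isSubordinate_chartAt_source (𝓡 n) M).choose_spec

variable {n M} [MeasurableSpace M]

/-- The volume measure `dv` of the metric induced by `X`: it is `√(det σᵢⱼ) du¹ ⋯ duⁿ` in the
coordinates of each chart, and these are glued by a partition of unity `(ρₓ)`, that is
`∫ f dv = ∑ₓ ∫ (ρₓ f)(u) √(det σᵢⱼ(u)) du`. -/
def volumeMeasure (X : M → Ambient n) : Measure M :=
  Measure.sum fun x : M ↦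
    ((volume.restrict (chartAt (EuclideanSpace ℝ (Fin n)) x).target).withDensity
      (fun u ↦ ENNReal.ofReal
        (chartPartition n M x ((chartAt (EuclideanSpace ℝ (Fin n)) x).symm u)
          * Real.sqrt (metricMatrix X x u).det))).map
      (chartAt (EuclideanSpace ℝ (Fin n)) x).symm

/-- The total mean curvature `∫ H dv`. -/
def totalMeanCurvature (X ν : M → Ambient n) : ℝ :=
  ∫ p, meanCurvature X ν p ∂(volumeMeasure X)

end Volume

end Hypersurface

end

/-! Write `Y = δX`, `S = σ⁻¹` and `B i j = ⟨∂ᵢX, ∂ⱼY⟩`, so that `δσ = B + Bᵀ`. Then `δS = -S δσ S`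
and `δ√det σ = ½ tr(S δσ) √det σ`. In `δhᵢⱼ = ⟨∂ᵢδν, ∂ⱼX⟩ + ⟨∂ᵢν, ∂ⱼY⟩` the field `∂ᵢν` is
tangential, so the last term is `(h S B) i j`, and symmetry of `S` and `h` gives `tr(S h S B) = ½
tr(S h S δσ)`. Altogether the density `H √det σ` varies by half the asserted density plus `σⁱʲ⟨∂ᵢδν,
∂ⱼX⟩ √det σ` (`hasDerivAt_meanCurvatureIn_mul_sqrt_det`). Since `|ν| = 1`, `δν` is tangential, and
the extra term is its divergence, whose integral over the closed hypersurface vanishes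
(`integral_meanCurvature_tangential`). If all induced metrics agree then `δσ = 0`, and the total
mean curvature has zero derivative on an interval.

The hypotheses give `ν` separately for each parameter, with no regularity at all; its joint
smoothness has to be proved (`contDiffOn_chartRep_normal`). Locally there is a smooth unit normal
`e` agreeing with `ν` at a base point, and `ν = ±e`. The sign cannot flip: a short segment in
direction `e` misses the hypersurface, uniformly in the family (`eventually_add_ne`), and its far
end stays in an unbounded component of the complement
(`eventually_not_isBounded_connectedComponentIn`), whereas `ν = -e` would put its near end in a
bounded one.

The scalars are defined at each point in that point's own chart. Coordinate independence
(`meanCurvatureIn_change`, `variationDensityIn_change`) allows them to be computed in a fixed chart,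
and a partition of unity reduces every integral to integrals with compact support in coordinate
space. -/

noncomputable section

namespace Hypersurface

/-! ### Derivatives of determinants and inverse matrices. -/

section MatrixCalculus

variable {ι : Type*} [Fintype ι] [DecidableEq ι]

/-- **Jacobi's formula** for the derivative of the determinant along a curve of matrices. -/
theorem hasDerivAt_det {G : ℝ → Matrix ι ι ℝ} {G' : Matrix ι ι ℝ} {t : ℝ}
    (h : ∀ i j, HasDerivAt (fun s ↦ G s i j) (G' i j) t) :
    HasDerivAt (fun s ↦ (G s).det) (((G t).adjugate * G').trace) t := by
  have h1 : HasDerivAt (fun s ↦ (G s).det)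
      (∑ i, ((G t).updateCol i (fun k ↦ G' k i)).det) t := by
    have : ∀ s, (G s).det = ∑ σ : Equiv.Perm ι, (Equiv.Perm.sign σ : ℝ) * ∏ i, G s (σ i) i :=
      fun s ↦ by rw [Matrix.det_apply']
    simp_rw [this]
    have h2 := HasDerivAt.fun_sum (u := (Finset.univ : Finset (Equiv.Perm ι))) (x := t)
      (A := fun σ s ↦ (Equiv.Perm.sign σ : ℝ) * ∏ i, G s (σ i) i)
      (A' := fun σ ↦ (Equiv.Perm.sign σ : ℝ) *
        ∑ i, (∏ k ∈ Finset.univ.erase i, G t (σ k) k) • G' (σ i) i)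
      (fun σ _ ↦ (HasDerivAt.fun_finsetProd (fun i _ ↦ h (σ i) i)).const_mul _)
    refine h2.congr_deriv (Eq.symm ?_)
    simp only [Matrix.det_apply', Finset.mul_sum]
    rw [Finset.sum_comm]
    refine Finset.sum_congr rfl fun σ _ ↦ Finset.sum_congr rfl fun i _ ↦ ?_
    rw [← Finset.mul_prod_erase _ _ (Finset.mem_univ i)]
    simp only [Matrix.updateCol_self, smul_eq_mul]
    rw [mul_comm (G' (σ i) i)]
    congr 2
    refine Finset.prod_congr rfl fun k hk ↦ ?_
    rw [Matrix.updateCol_ne (Finset.ne_of_mem_erase hk)]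
  refine h1.congr_deriv (Eq.symm ?_)
  rw [Matrix.trace]
  refine Finset.sum_congr rfl fun i _ ↦ ?_
  rw [← Matrix.cramer_apply, Matrix.cramer_eq_adjugate_mulVec]
  rfl

theorem contDiffOn_det {E : Type*} [NormedAddCommGroup E] [NormedSpace ℝ E] {s : Set E}
    {r : WithTop ℕ∞} {G : E → Matrix ι ι ℝ} (h : ∀ i j, ContDiffOn ℝ r (fun q ↦ G q i j) s) :
    ContDiffOn ℝ r (fun q ↦ (G q).det) s := by
  simp_rw [Matrix.det_apply']
  exact ContDiffOn.sum fun σ _ ↦ contDiffOn_const.mul (contDiffOn_prod fun i _ ↦ h _ _)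

theorem contDiffOn_inv_apply {E : Type*} [NormedAddCommGroup E] [NormedSpace ℝ E] {s : Set E}
    {r : WithTop ℕ∞} {G : E → Matrix ι ι ℝ} (h : ∀ i j, ContDiffOn ℝ r (fun q ↦ G q i j) s)
    (hdet : ∀ q ∈ s, (G q).det ≠ 0) (i j : ι) :
    ContDiffOn ℝ r (fun q ↦ (G q)⁻¹ i j) s := by
  simp_rw [Matrix.inv_def, Matrix.smul_apply, Ring.inverse_eq_inv', smul_eq_mul,
    Matrix.adjugate_apply]
  refine ((contDiffOn_det h).inv hdet).mul (contDiffOn_det fun k l ↦ ?_)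
  by_cases hk : k = j
  · subst hk
    simpa using contDiffOn_const
  · simpa [Matrix.updateRow_ne hk] using h k l

/-- The adjugate formula gives differentiability; differentiating `G G⁻¹ = 1`, which holds near `t`,
then forces the value. -/
theorem hasDerivAt_inv_apply {G : ℝ → Matrix ι ι ℝ} {G' : Matrix ι ι ℝ} {t : ℝ}
    (h : ∀ i j, HasDerivAt (fun s ↦ G s i j) (G' i j) t) (hdet : (G t).det ≠ 0) (i j : ι) :
    HasDerivAt (fun s ↦ (G s)⁻¹ i j) ((-((G t)⁻¹ * G' * (G t)⁻¹)) i j) t := by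
  have hd : ∀ k l, DifferentiableAt ℝ (fun s ↦ (G s)⁻¹ k l) t := by
    intro k l
    simp_rw [Matrix.inv_def, Matrix.smul_apply, Ring.inverse_eq_inv', smul_eq_mul,
      Matrix.adjugate_apply]
    -- An adjugate entry is the determinant with row `l` replaced by a constant basis vector, so row
    -- `l` contributes derivative zero.
    refine ((hasDerivAt_det h).differentiableAt.inv hdet).mul
      (hasDerivAt_det (G' := fun a b ↦ if a = l then 0 else G' a b) fun a b ↦ ?_).differentiableAt
    by_cases ha : a = l
    · subst ha
      simpa using hasDerivAt_const t ((Pi.single k 1 : ι → ℝ) b)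
    · simpa [Matrix.updateRow_ne ha, ha] using h a b
  let I' : Matrix ι ι ℝ := Matrix.of fun k l ↦ deriv (fun s ↦ (G s)⁻¹ k l) t
  have hI : ∀ k l, HasDerivAt (fun s ↦ (G s)⁻¹ k l) (I' k l) t := fun k l ↦ (hd k l).hasDerivAt
  have hev : ∀ᶠ s in 𝓝 t, (G s).det ≠ 0 :=
    (hasDerivAt_det h).continuousAt.eventually_ne hdet
  have hprod : G' * (G t)⁻¹ + G t * I' = 0 := by
    ext k l
    have h1 : HasDerivAt (fun s ↦ (G s * (G s)⁻¹) k l) ((G' * (G t)⁻¹ + G t * I') k l) t := by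
      simp_rw [Matrix.mul_apply, Matrix.add_apply, Matrix.mul_apply, ← Finset.sum_add_distrib]
      exact HasDerivAt.fun_sum fun m _ ↦ (h k m).mul (hI m l)
    have h2 : HasDerivAt (fun s ↦ (G s * (G s)⁻¹) k l) 0 t := by
      refine (hasDerivAt_const t ((1 : Matrix ι ι ℝ) k l)).congr_of_eventuallyEq ?_
      filter_upwards [hev] with s hs
      rw [Matrix.mul_nonsing_inv _ (isUnit_iff_ne_zero.2 hs)]
    exact h1.unique h2
  have : I' = -((G t)⁻¹ * G' * (G t)⁻¹) := by
    have h3 : (G t)⁻¹ * (G' * (G t)⁻¹ + G t * I') = 0 := by rw [hprod, mul_zero]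
    rw [mul_add, ← mul_assoc, ← mul_assoc, Matrix.nonsing_inv_mul _ (isUnit_iff_ne_zero.2 hdet),
      one_mul] at h3
    exact eq_neg_of_add_eq_zero_right h3
  rw [← this]
  exact hI i j

/-- Jacobi's formula with the adjugate written as determinant times inverse; it governs both the
variation of the volume density and its coordinate derivatives. -/
theorem hasDerivAt_sqrt_det {G : ℝ → Matrix ι ι ℝ} {G' : Matrix ι ι ℝ} {t : ℝ}
    (h : ∀ i j, HasDerivAt (fun s ↦ G s i j) (G' i j) t) (hdet : 0 < (G t).det) :
    HasDerivAt (fun s ↦ √(G s).det) (1 / 2 * ((G t)⁻¹ * G').trace * √(G t).det) t := by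
  refine ((hasDerivAt_det h).sqrt hdet.ne').congr_deriv (Eq.symm ?_)
  rw [Matrix.inv_def, Ring.inverse_eq_inv', Matrix.smul_mul, Matrix.trace_smul, smul_eq_mul]
  have h1 : √(G t).det * √(G t).det = (G t).det := Real.mul_self_sqrt hdet.le
  have h2 : √(G t).det ≠ 0 := (Real.sqrt_pos.2 hdet).ne'
  field_simp
  rw [sq, h1, mul_comm]

/-- The algebraic identity behind the variation of the trace of the shape operator. -/
theorem trace_variation_identity {S h B : Matrix ι ι ℝ} (hS : S.transpose = S)
    (hh : h.transpose = h) :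
    (S * (h * S * B)).trace = 1 / 2 * (S * h * S * (B + B.transpose)).trace := by
  -- Transposition reverses the product without changing its trace, and fixes `S` and `h`.
  have : (S * h * S * B.transpose).trace = (S * (h * S * B)).trace := by
    rw [← Matrix.trace_transpose]
    simp only [Matrix.transpose_mul, Matrix.transpose_transpose, hS, hh]
    rw [Matrix.trace_mul_comm]
    simp only [mul_assoc]
  rw [mul_add, Matrix.trace_add, this]
  simp only [mul_assoc]
  ring

end MatrixCalculus

/-! ### Tangent bases and normals of hyperplanes. -/

section LinearAlgebra

variable {n : ℕ} {v : Fin n → Ambient n} {N : Ambient n}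

/-- The vectors normal to a hyperplane of `ℝ^(n+1)` form a line. -/
theorem exists_eq_smul_of_orthogonal (hv : LinearIndependent ℝ v) (hN : N ≠ 0)
    (hNv : ∀ i, inner ℝ N (v i) = 0) {d : Ambient n} (hd : ∀ i, inner ℝ d (v i) = 0) :
    ∃ c : ℝ, d = c • N := by
  let K : Submodule ℝ (Ambient n) := Submodule.span ℝ (range v)
  have hmem : ∀ w : Ambient n, (∀ i, inner ℝ w (v i) = 0) → w ∈ Kᗮ := by
    intro w hw
    rw [Submodule.mem_orthogonal']
    intro z hz
    induction hz using Submodule.span_induction with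
    | mem y hy => obtain ⟨i, rfl⟩ := hy; exact hw i
    | zero => simp
    | add a b _ _ ha hb => rw [inner_add_right, ha, hb, add_zero]
    | smul c a _ ha => rw [inner_smul_right, ha, mul_zero]
  have hK : Module.finrank ℝ K = n := by
    rw [finrank_span_eq_card hv, Fintype.card_fin]
  have hK' : Module.finrank ℝ Kᗮ = 1 := by
    have := K.finrank_add_finrank_orthogonal
    rw [hK, finrank_euclideanSpace, Fintype.card_fin] at this
    omega
  obtain ⟨c, hc⟩ := (finrank_eq_one_iff_of_nonzero' (⟨N, hmem N hNv⟩ : Kᗮ)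
    (fun h ↦ hN (congrArg Subtype.val h))).1 hK' ⟨d, hmem d hd⟩
  exact ⟨c, (congrArg Subtype.val hc).symm⟩

theorem eq_zero_of_orthogonal (hv : LinearIndependent ℝ v) (hN : N ≠ 0)
    (hNv : ∀ i, inner ℝ N (v i) = 0) {d : Ambient n} (hd : ∀ i, inner ℝ d (v i) = 0)
    (hdN : inner ℝ d N = 0) : d = 0 := by
  obtain ⟨c, rfl⟩ := exists_eq_smul_of_orthogonal hv hN hNv hd
  rw [inner_smul_left] at hdN
  simp only [conj_trivial, mul_eq_zero, inner_self_eq_zero, hN, or_false] at hdN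
  rw [hdN, zero_smul]

theorem det_gram_pos (hv : LinearIndependent ℝ v) : 0 < (Matrix.gram ℝ v).det :=
  (Matrix.posDef_gram_of_linearIndependent hv).det_pos

theorem gram_transpose (v : Fin n → Ambient n) :
    (Matrix.gram ℝ v).transpose = Matrix.gram ℝ v := by
  ext i j
  simp [Matrix.gram_apply, real_inner_comm]

theorem gram_inv_transpose (v : Fin n → Ambient n) :
    ((Matrix.gram ℝ v)⁻¹).transpose = (Matrix.gram ℝ v)⁻¹ := by
  rw [Matrix.transpose_nonsing_inv, gram_transpose]

/-- The tangential projection of `w` with respect to the tangent basis `v`. -/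
def tangentialPart (v : Fin n → Ambient n) (w : Ambient n) : Ambient n :=
  ∑ l, (∑ k, (Matrix.gram ℝ v)⁻¹ l k * inner ℝ w (v k)) • v l

theorem inner_tangentialPart (hv : LinearIndependent ℝ v) (w : Ambient n) (i : Fin n) :
    inner ℝ (tangentialPart v w) (v i) = inner ℝ w (v i) := by
  have h1 : (Matrix.gram ℝ v) * (Matrix.gram ℝ v)⁻¹ = 1 :=
    Matrix.mul_nonsing_inv _ (isUnit_iff_ne_zero.2 (det_gram_pos hv).ne')
  have h2 : Matrix.mulVec (Matrix.gram ℝ v) (Matrix.mulVec (Matrix.gram ℝ v)⁻¹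
      (fun k ↦ inner ℝ w (v k))) i = inner ℝ w (v i) := by
    rw [Matrix.mulVec_mulVec, h1, Matrix.one_mulVec]
  rw [← h2, tangentialPart, sum_inner]
  simp only [inner_smul_left, Matrix.mulVec, dotProduct, conj_trivial, Matrix.gram_apply]
  exact Finset.sum_congr rfl fun l _ ↦ by rw [mul_comm, real_inner_comm]

theorem inner_tangentialPart_normal (hNv : ∀ i, inner ℝ N (v i) = 0) (w : Ambient n) :
    inner ℝ (tangentialPart v w) N = 0 := by
  rw [tangentialPart, sum_inner]
  refine Finset.sum_eq_zero fun l _ ↦ ?_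
  rw [inner_smul_left, real_inner_comm, hNv, mul_zero]

/-- The difference is orthogonal both to the tangent basis and to `N`, hence zero by dimension. This
is what expands `∂ᵢν` and tangential fields in the coordinate basis. -/
theorem tangentialPart_eq_self (hv : LinearIndependent ℝ v) (hN : N ≠ 0)
    (hNv : ∀ i, inner ℝ N (v i) = 0) {w : Ambient n} (hw : inner ℝ w N = 0) :
    tangentialPart v w = w := by
  refine sub_eq_zero.1 (eq_zero_of_orthogonal hv hN hNv (fun i ↦ ?_) ?_)
  · rw [inner_sub_left, inner_tangentialPart hv, sub_self]
  · rw [inner_sub_left, inner_tangentialPart_normal hNv, hw, sub_self]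

end LinearAlgebra

/-! ### Second derivatives and partial derivatives. -/

section Calculus

variable {E F : Type*} [NormedAddCommGroup E] [NormedSpace ℝ E]
  [NormedAddCommGroup F] [NormedSpace ℝ F]

theorem contDiffOn_fderiv_apply {f : E → F} {s : Set E} (hf : ContDiffOn ℝ ∞ f s)
    (hs : IsOpen s) (v : E) : ContDiffOn ℝ ∞ (fun q ↦ fderiv ℝ f q v) s :=
  (hf.fderiv_of_isOpen hs (m := ∞) (by simp)).clm_apply contDiffOn_const

theorem differentiableAt_of_contDiffOn {f : E → F} {s : Set E} (hf : ContDiffOn ℝ ∞ f s)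
    (hs : IsOpen s) {q : E} (hq : q ∈ s) : DifferentiableAt ℝ f q :=
  ((hf q hq).contDiffAt (hs.mem_nhds hq)).differentiableAt (by simp)

/-- Schwarz's theorem serves three times: to exchange parameter and coordinate derivatives, for the
symmetry of `h`, and for the symmetry of the Christoffel symbols. -/
theorem fderiv_fderiv_comm {f : E → F} {s : Set E} (hf : ContDiffOn ℝ ∞ f s)
    (hs : IsOpen s) {q : E} (hq : q ∈ s) (v w : E) :
    fderiv ℝ (fun p ↦ fderiv ℝ f p v) q w = fderiv ℝ (fun p ↦ fderiv ℝ f p w) q v := by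
  have hf' := (hf q hq).contDiffAt (hs.mem_nhds hq)
  have hd : DifferentiableAt ℝ (fderiv ℝ f) q :=
    differentiableAt_of_contDiffOn (hf.fderiv_of_isOpen hs (m := ∞) (by simp)) hs hq
  have h : ∀ v w, fderiv ℝ (fun p ↦ fderiv ℝ f p v) q w = fderiv ℝ (fderiv ℝ f) q w v := by
    intro v w
    rw [fderiv_clm_apply hd (differentiableAt_const v)]
    simp
  rw [h, h]
  exact (hf'.isSymmSndFDerivAt (by simpa using WithTop.coe_le_coe.2 (le_top : (2 : ℕ∞) ≤ ⊤))).eq w v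

theorem fderiv_slice_right {f : ℝ × E → F} {s : ℝ} {u : E} (hf : DifferentiableAt ℝ f (s, u))
    (w : E) : fderiv ℝ (fun u' ↦ f (s, u')) u w = fderiv ℝ f (s, u) (0, w) := by
  have h := hf.hasFDerivAt.comp u (hasFDerivAt_prodMk_right s u)
  have h' : fderiv ℝ (fun u' ↦ f (s, u')) u = _ := h.fderiv
  rw [h']
  simp

theorem hasDerivAt_slice_left {f : ℝ × E → F} {s : ℝ} {u : E}
    (hf : DifferentiableAt ℝ f (s, u)) :
    HasDerivAt (fun t ↦ f (t, u)) (fderiv ℝ f (s, u) (1, 0)) s :=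
  hf.hasFDerivAt.comp_hasDerivAt s ((hasDerivAt_id s).prodMk (hasDerivAt_const s u))

end Calculus

/-! ### The variation formula in one chart. -/

section LocalGeometry

variable {n : ℕ} {M : Type*} [TopologicalSpace M] [ChartedSpace (EuclideanSpace ℝ (Fin n)) M]

/-- The family `X` in the chart attached to `x`, as a function of the parameter and the
coordinates. -/
def chartRep {F : Type*} (X : ℝ → M → F) (x : M) (q : ℝ × EuclideanSpace ℝ (Fin n)) : F :=
  X q.1 ((chartAt (EuclideanSpace ℝ (Fin n)) x).symm q.2)

/-- `σⁱʲ ⟨∂W/∂uⁱ, ∂X/∂uʲ⟩` in the chart attached to `x`. -/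
def meanCurvatureIn (X W : M → Ambient n) (x : M) (u : EuclideanSpace ℝ (Fin n)) : ℝ :=
  ∑ i, ∑ j, (metricMatrix X x u)⁻¹ i j * sffMatrix X W x u i j

/-- The scalar `(H σⁱʲ - σⁱᵏ σʲˡ hₖₗ) δσᵢⱼ` in the chart attached to `x`. -/
def variationDensityIn (X ν : ℝ → M → Ambient n) (s : ℝ) (x : M)
    (u : EuclideanSpace ℝ (Fin n)) : ℝ :=
  ∑ i, ∑ j, (meanCurvatureIn (X s) (ν s) x u * (metricMatrix (X s) x u)⁻¹ i j
      - ∑ k, ∑ l, (metricMatrix (X s) x u)⁻¹ i k * (metricMatrix (X s) x u)⁻¹ j l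
        * sffMatrix (X s) (ν s) x u k l)
    * deriv (fun t ↦ metricMatrix (X t) x u i j) s

theorem metricMatrix_eq_gram (X : M → Ambient n) (x : M) (u : EuclideanSpace ℝ (Fin n)) :
    metricMatrix X x u = Matrix.gram ℝ (coordDeriv X x u) := rfl

theorem coordDeriv_eq_fderiv_chartRep {X : ℝ → M → Ambient n} {x : M} {s : ℝ}
    {u : EuclideanSpace ℝ (Fin n)} (h : DifferentiableAt ℝ (chartRep X x) (s, u)) (i : Fin n) :
    coordDeriv (X s) x u i = fderiv ℝ (chartRep X x) (s, u) (0, EuclideanSpace.single i 1) :=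
  fderiv_slice_right h _

section Smoothness

variable {Q : Type*} [NormedAddCommGroup Q] [NormedSpace ℝ Q] {Ω : Set Q}
  {X W : Q → M → Ambient n} {x : M} {u : Q → EuclideanSpace ℝ (Fin n)}

/-- The parameter space `Q` is left general so that the same lemmas apply to one hypersurface (`u =
id`) and to the family (`Q` the product of parameter and coordinates). -/
theorem contDiffOn_metricMatrix
    (hX : ∀ i, ContDiffOn ℝ ∞ (fun q ↦ coordDeriv (X q) x (u q) i) Ω) (i j : Fin n) :
    ContDiffOn ℝ ∞ (fun q ↦ metricMatrix (X q) x (u q) i j) Ω :=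
  (hX i).inner ℝ (hX j)

theorem contDiffOn_sqrt_det_metricMatrix
    (hX : ∀ i, ContDiffOn ℝ ∞ (fun q ↦ coordDeriv (X q) x (u q) i) Ω)
    (hli : ∀ q ∈ Ω, LinearIndependent ℝ (coordDeriv (X q) x (u q))) :
    ContDiffOn ℝ ∞ (fun q ↦ √(metricMatrix (X q) x (u q)).det) Ω :=
  (contDiffOn_det (contDiffOn_metricMatrix hX)).sqrt fun q hq ↦ (det_gram_pos (hli q hq)).ne'

theorem contDiffOn_metricMatrix_inv
    (hX : ∀ i, ContDiffOn ℝ ∞ (fun q ↦ coordDeriv (X q) x (u q) i) Ω)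
    (hli : ∀ q ∈ Ω, LinearIndependent ℝ (coordDeriv (X q) x (u q))) (i j : Fin n) :
    ContDiffOn ℝ ∞ (fun q ↦ (metricMatrix (X q) x (u q))⁻¹ i j) Ω :=
  contDiffOn_inv_apply (contDiffOn_metricMatrix hX) (fun q hq ↦ (det_gram_pos (hli q hq)).ne') i j

theorem contDiffOn_meanCurvatureIn
    (hX : ∀ i, ContDiffOn ℝ ∞ (fun q ↦ coordDeriv (X q) x (u q) i) Ω)
    (hW : ∀ i, ContDiffOn ℝ ∞ (fun q ↦ coordDeriv (W q) x (u q) i) Ω)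
    (hli : ∀ q ∈ Ω, LinearIndependent ℝ (coordDeriv (X q) x (u q))) :
    ContDiffOn ℝ ∞ (fun q ↦ meanCurvatureIn (X q) (W q) x (u q)) Ω :=
  ContDiffOn.sum fun i _ ↦ ContDiffOn.sum fun j _ ↦
    (contDiffOn_metricMatrix_inv hX hli i j).mul ((hW i).inner ℝ (hX j))

theorem contDiffOn_coordDeriv {F : M → Ambient n} {V : Set (EuclideanSpace ℝ (Fin n))}
    (hV : IsOpen V)
    (hF : ContDiffOn ℝ ∞ (F ∘ (chartAt (EuclideanSpace ℝ (Fin n)) x).symm) V) (i : Fin n) :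
    ContDiffOn ℝ ∞ (fun u ↦ coordDeriv F x u i) V :=
  contDiffOn_fderiv_apply hF hV _

theorem contDiffOn_coordDeriv_family {X : ℝ → M → Ambient n}
    {Ω : Set (ℝ × EuclideanSpace ℝ (Fin n))} (hΩ : IsOpen Ω)
    (hX : ContDiffOn ℝ ∞ (chartRep X x) Ω) (i : Fin n) :
    ContDiffOn ℝ ∞ (fun q ↦ coordDeriv (X q.1) x q.2 i) Ω :=
  (contDiffOn_fderiv_apply hX hΩ (0, EuclideanSpace.single i 1)).congr fun _ hq ↦
    coordDeriv_eq_fderiv_chartRep (differentiableAt_of_contDiffOn hX hΩ hq) i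

end Smoothness

section Variation

variable {X ν : ℝ → M → Ambient n} {x : M} {Ω : Set (ℝ × EuclideanSpace ℝ (Fin n))}
  {s : ℝ} {u : EuclideanSpace ℝ (Fin n)}

/-- The parameter derivative commutes with the coordinate derivatives. -/
theorem hasDerivAt_coordDeriv (hΩ : IsOpen Ω) (hX : ContDiffOn ℝ ∞ (chartRep X x) Ω)
    (hq : (s, u) ∈ Ω) (i : Fin n) :
    HasDerivAt (fun t ↦ coordDeriv (X t) x u i)
      (coordDeriv (fun p ↦ deriv (fun t ↦ X t p) s) x u i) s := by
  let e : ℝ × EuclideanSpace ℝ (Fin n) := (0, EuclideanSpace.single i 1)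
  have h1 : ContDiffOn ℝ ∞ (fun q ↦ fderiv ℝ (chartRep X x) q e) Ω :=
    contDiffOn_fderiv_apply hX hΩ e
  have h2 := hasDerivAt_slice_left (differentiableAt_of_contDiffOn h1 hΩ hq)
  have hs : ∀ᶠ t in 𝓝 s, (t, u) ∈ Ω :=
    (Continuous.prodMk_left u).continuousAt.preimage_mem_nhds (hΩ.mem_nhds hq)
  have h3 : HasDerivAt (fun t ↦ coordDeriv (X t) x u i)
      (fderiv ℝ (fun q ↦ fderiv ℝ (chartRep X x) q e) (s, u) (1, 0)) s := by
    refine h2.congr_of_eventuallyEq ?_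
    filter_upwards [hs] with t ht
    exact coordDeriv_eq_fderiv_chartRep (differentiableAt_of_contDiffOn hX hΩ ht) i
  refine h3.congr_deriv ?_
  have h4 : ContDiffOn ℝ ∞ (fun q ↦ fderiv ℝ (chartRep X x) q (1, 0)) Ω :=
    contDiffOn_fderiv_apply hX hΩ _
  rw [fderiv_fderiv_comm hX hΩ hq,
    ← fderiv_slice_right (differentiableAt_of_contDiffOn h4 hΩ hq)]
  have hu : ∀ᶠ u' in 𝓝 u, (s, u') ∈ Ω :=
    (Continuous.prodMk_right s).continuousAt.preimage_mem_nhds (hΩ.mem_nhds hq)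
  unfold coordDeriv
  congr 1
  refine Filter.EventuallyEq.fderiv_eq ?_
  filter_upwards [hu] with u' hu'
  exact (hasDerivAt_slice_left (differentiableAt_of_contDiffOn hX hΩ hu')).deriv.symm

theorem hasDerivAt_metricMatrix (hΩ : IsOpen Ω) (hX : ContDiffOn ℝ ∞ (chartRep X x) Ω)
    (hq : (s, u) ∈ Ω) (i j : Fin n) :
    HasDerivAt (fun t ↦ metricMatrix (X t) x u i j)
      (inner ℝ (coordDeriv (X s) x u i) (coordDeriv (fun p ↦ deriv (fun t ↦ X t p) s) x u j)
        + inner ℝ (coordDeriv (fun p ↦ deriv (fun t ↦ X t p) s) x u i) (coordDeriv (X s) x u j))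
      s :=
  (hasDerivAt_coordDeriv hΩ hX hq i).inner ℝ (hasDerivAt_coordDeriv hΩ hX hq j)

/-- Coordinate derivatives of a unit field are orthogonal to it. -/
theorem inner_coordDeriv_unit {N : M → Ambient n} (hN : ∀ p, ‖N p‖ = 1)
    (hd : DifferentiableAt ℝ (N ∘ (chartAt (EuclideanSpace ℝ (Fin n)) x).symm) u) (i : Fin n) :
    inner ℝ (coordDeriv N x u i) (N ((chartAt (EuclideanSpace ℝ (Fin n)) x).symm u)) = 0 := by
  have h1 := fderiv_inner_apply ℝ hd hd (EuclideanSpace.single i 1)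
  have h2 : (fun t ↦ inner ℝ ((N ∘ (chartAt (EuclideanSpace ℝ (Fin n)) x).symm) t)
      ((N ∘ (chartAt (EuclideanSpace ℝ (Fin n)) x).symm) t)) = fun _ ↦ (1 : ℝ) := by
    funext t
    simp [hN]
  rw [h2] at h1
  simp only [fderiv_fun_const, Pi.zero_apply, _root_.zero_apply] at h1
  rw [real_inner_comm _ ((N ∘ _) u)] at h1
  have : coordDeriv N x u i = fderiv ℝ (N ∘ (chartAt (EuclideanSpace ℝ (Fin n)) x).symm) u
    (EuclideanSpace.single i 1) := rfl
  rw [this]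
  simp only [Function.comp_apply] at h1
  linarith

/-- The second fundamental form is symmetric. -/
theorem sffMatrix_transpose {X N : M → Ambient n} {V : Set (EuclideanSpace ℝ (Fin n))}
    (hV : IsOpen V)
    (hX : ContDiffOn ℝ ∞ (X ∘ (chartAt (EuclideanSpace ℝ (Fin n)) x).symm) V)
    (hN : ContDiffOn ℝ ∞ (N ∘ (chartAt (EuclideanSpace ℝ (Fin n)) x).symm) V)
    (horth : ∀ u ∈ V, ∀ i, inner ℝ (N ((chartAt (EuclideanSpace ℝ (Fin n)) x).symm u))
      (coordDeriv X x u i) = 0) (hu : u ∈ V) :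
    (sffMatrix X N x u).transpose = sffMatrix X N x u := by
  -- Differentiating `⟨N, ∂ⱼX⟩ = 0` turns `hᵢⱼ` into `-⟨N, ∂ᵢ∂ⱼX⟩`, which is visibly symmetric.
  have key : ∀ i j, sffMatrix X N x u i j =
      - inner ℝ (N ((chartAt (EuclideanSpace ℝ (Fin n)) x).symm u))
        (fderiv ℝ (fun u ↦ coordDeriv X x u j) u (EuclideanSpace.single i 1)) := by
    intro i j
    have h1 := fderiv_inner_apply ℝ (differentiableAt_of_contDiffOn hN hV hu)
      (differentiableAt_of_contDiffOn (contDiffOn_coordDeriv hV hX j) hV hu)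
      (EuclideanSpace.single i 1)
    have h2 : (fun t ↦ inner ℝ ((N ∘ (chartAt (EuclideanSpace ℝ (Fin n)) x).symm) t)
        (coordDeriv X x t j)) =ᶠ[𝓝 u] fun _ ↦ (0 : ℝ) := by
      filter_upwards [hV.mem_nhds hu] with t ht using horth t ht j
    rw [h2.fderiv_eq] at h1
    simp only [fderiv_fun_const, Pi.zero_apply, _root_.zero_apply] at h1
    exact eq_neg_of_add_eq_zero_right h1.symm
  ext i j
  rw [Matrix.transpose_apply, key, key]
  congr 2
  exact fderiv_fderiv_comm hX hV hu _ _

/-- The pointwise variation formula for the density `H √(det σ)` of the total mean curvature. -/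
theorem hasDerivAt_meanCurvatureIn_mul_sqrt_det (hΩ : IsOpen Ω)
    (hX : ContDiffOn ℝ ∞ (chartRep X x) Ω) (hν : ContDiffOn ℝ ∞ (chartRep ν x) Ω)
    (hq : (s, u) ∈ Ω) (hli : LinearIndependent ℝ (coordDeriv (X s) x u))
    (hunit : ∀ p, ‖ν s p‖ = 1)
    (horth : ∀ u', (s, u') ∈ Ω → ∀ i,
      inner ℝ (ν s ((chartAt (EuclideanSpace ℝ (Fin n)) x).symm u'))
        (coordDeriv (X s) x u' i) = 0) :
    HasDerivAt (fun t ↦ meanCurvatureIn (X t) (ν t) x u * √(metricMatrix (X t) x u).det)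
      ((1 / 2 * variationDensityIn X ν s x u
        + meanCurvatureIn (X s) (fun p ↦ deriv (fun t ↦ ν t p) s) x u)
        * √(metricMatrix (X s) x u).det) s := by
  set S := (metricMatrix (X s) x u)⁻¹ with hS
  set h := sffMatrix (X s) (ν s) x u with hh
  let Y : M → Ambient n := fun p ↦ deriv (fun t ↦ X t p) s
  let B : Matrix (Fin n) (Fin n) ℝ := Matrix.of fun i j ↦
    inner ℝ (coordDeriv (X s) x u i) (coordDeriv Y x u j)
  let K : Matrix (Fin n) (Fin n) ℝ := sffMatrix (X s) (fun p ↦ deriv (fun t ↦ ν t p) s) x u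
  have hG : ∀ i j, HasDerivAt (fun t ↦ metricMatrix (X t) x u i j) ((B + B.transpose) i j) s := by
    intro i j
    refine (hasDerivAt_metricMatrix hΩ hX hq i j).congr_deriv ?_
    simp only [Matrix.add_apply, Matrix.transpose_apply, B, Matrix.of_apply, Y]
    rw [real_inner_comm (coordDeriv _ x u i) (coordDeriv (X s) x u j)]
  have hV : IsOpen {u' | (s, u') ∈ Ω} := hΩ.preimage (Continuous.prodMk_right s)
  have hslice : ∀ {Z : ℝ → M → Ambient n}, ContDiffOn ℝ ∞ (chartRep Z x) Ω →
      ContDiffOn ℝ ∞ (Z s ∘ (chartAt (EuclideanSpace ℝ (Fin n)) x).symm) {u' | (s, u') ∈ Ω} :=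
    fun hZ ↦ hZ.comp (contDiff_prodMk_right s).contDiffOn fun _ h ↦ h
  have hSt : S.transpose = S := gram_inv_transpose _
  have hht : h.transpose = h := sffMatrix_transpose hV (hslice hX) (hslice hν) horth hq
  have hN0 : ν s ((chartAt (EuclideanSpace ℝ (Fin n)) x).symm u) ≠ 0 := by
    rw [← norm_ne_zero_iff, hunit]
    exact one_ne_zero
  -- Weingarten's equation: `∂ᵢν` is orthogonal to the unit field `ν`, so it equals its tangential
  -- part, with coefficients `h S`.
  have hL : ∀ i j, inner ℝ (coordDeriv (ν s) x u i) (coordDeriv Y x u j) = (h * S * B) i j := by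
    intro i j
    have h1 := tangentialPart_eq_self hli hN0 (horth u hq) (inner_coordDeriv_unit hunit
      (differentiableAt_of_contDiffOn (hslice hν) hV hq) i)
    rw [← h1, tangentialPart, sum_inner, Matrix.mul_apply]
    refine Finset.sum_congr rfl fun l _ ↦ ?_
    rw [inner_smul_left, conj_trivial, Matrix.mul_apply]
    congr 1
    refine Finset.sum_congr rfl fun k _ ↦ ?_
    rw [mul_comm]
    congr 1
    exact congrFun (congrFun hSt k) l
  -- `K` collects the terms with `∂ᵢδν`; its trace against `S` is the divergence term left over at
  -- the end.
  have hh' : ∀ i j, HasDerivAt (fun t ↦ sffMatrix (X t) (ν t) x u i j)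
      ((h * S * B + K) i j) s := by
    intro i j
    refine ((hasDerivAt_coordDeriv hΩ hν hq i).inner ℝ
      (hasDerivAt_coordDeriv hΩ hX hq j)).congr_deriv ?_
    rw [Matrix.add_apply, ← hL]
    rfl
  have hdet : 0 < (metricMatrix (X s) x u).det := det_gram_pos hli
  have hinv := hasDerivAt_inv_apply hG hdet.ne'
  have htr : ∀ A C : Matrix (Fin n) (Fin n) ℝ, ∑ i, ∑ j, A i j * C i j
      = (A * C.transpose).trace := by
    intro A C
    simp [Matrix.trace, Matrix.mul_apply]
  have hHd : HasDerivAt (fun t ↦ meanCurvatureIn (X t) (ν t) x u)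
      (∑ i, ∑ j, ((-(S * (B + B.transpose) * S)) i j * h i j
        + S i j * (h * S * B + K) i j)) s :=
    HasDerivAt.fun_sum fun i _ ↦ HasDerivAt.fun_sum fun j _ ↦ (hinv i j).mul (hh' i j)
  refine (hHd.mul (hasDerivAt_sqrt_det hG hdet)).congr_deriv ?_
  have hvar : variationDensityIn X ν s x u
      = (S * h).trace * (S * (B + B.transpose)).trace
        - (S * h * S * (B + B.transpose)).trace := by
    have hmc : meanCurvatureIn (X s) (ν s) x u = (S * h).trace := by
      rw [meanCurvatureIn, htr, hht]
    have hShS : ∀ i j, ∑ k, ∑ l, S i k * S j l * h k l = (S * h * S) i j := by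
      intro i j
      rw [Matrix.mul_apply, Finset.sum_comm]
      refine Finset.sum_congr rfl fun l _ ↦ ?_
      rw [Matrix.mul_apply, Finset.sum_mul]
      refine Finset.sum_congr rfl fun k _ ↦ ?_
      rw [show S l j = S j l from congrFun (congrFun hSt j) l]
      ring
    have hBt : (B + B.transpose).transpose = B + B.transpose := by
      rw [Matrix.transpose_add, Matrix.transpose_transpose, add_comm]
    have hsum : variationDensityIn X ν s x u = ∑ i, ∑ j,
        ((S * h).trace • S - S * h * S) i j * (B + B.transpose) i j := by
      refine Finset.sum_congr rfl fun i _ ↦ Finset.sum_congr rfl fun j _ ↦ ?_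
      rw [(hG i j).deriv, hmc, hShS]
      rfl
    rw [hsum, htr, hBt, sub_mul, Matrix.trace_sub, Matrix.smul_mul, Matrix.trace_smul,
      smul_eq_mul]
  have hmc : meanCurvatureIn (X s) (ν s) x u = (S * h).trace := by
    rw [meanCurvatureIn, htr, hht]
  have hmc' : meanCurvatureIn (X s) (fun p ↦ deriv (fun t ↦ ν t p) s) x u
      = ∑ i, ∑ j, S i j * K i j := rfl
  have hsplit : ∀ D : Matrix (Fin n) (Fin n) ℝ, ∑ i, ∑ j, ((-(S * D * S)) i j * h i j
        + S i j * (h * S * B + K) i j)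
      = -(S * h * S * D).trace + (S * (h * S * B)).trace
        + ∑ i, ∑ j, S i j * K i j := by
    intro D
    simp only [Finset.sum_add_distrib, Matrix.add_apply, mul_add]
    rw [htr, htr, hht, add_assoc]
    congr 1
    · rw [Matrix.neg_mul, Matrix.trace_neg, mul_assoc (S * _) S h, Matrix.trace_mul_comm,
        ← mul_assoc (S * h) S]
    · congr 1
      rw [← Matrix.trace_transpose, Matrix.transpose_mul, Matrix.transpose_transpose,
        hSt, Matrix.trace_mul_comm]
  -- The coefficient of `tr(S h S δσ)` is `-1` from `δS` plus `1/2` from `δh`.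
  rw [hsplit, trace_variation_identity hSt hht, hvar, hmc, hmc']
  ring

end Variation

end LocalGeometry

/-! ### The divergence theorem in one chart. -/

section LocalDivergence

/-- The integral of a directional derivative of a compactly supported function vanishes. -/
theorem integral_fderiv_apply_eq_zero {E : Type*} [NormedAddCommGroup E] [NormedSpace ℝ E]
    [FiniteDimensional ℝ E] [MeasurableSpace E] [BorelSpace E] (μ : Measure E)
    [μ.IsAddHaarMeasure] {f : E → ℝ} (hf : ContDiff ℝ 1 f) (hc : HasCompactSupport f) (v : E) :
    ∫ x, fderiv ℝ f x v ∂μ = 0 := by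
  have hd : Continuous fun x ↦ fderiv ℝ f x v :=
    (hf.continuous_fderiv one_ne_zero).clm_apply continuous_const
  have hdc : HasCompactSupport fun x ↦ fderiv ℝ f x v := hc.fderiv_apply (𝕜 := ℝ) v
  -- Integration by parts against the constant function one.
  have := integral_mul_fderiv_eq_neg_fderiv_mul_of_integrable (μ := μ) (f := fun _ : E ↦ (1 : ℝ))
    (g := f) (v := v) (by simp) (by simpa using hd.integrable_of_hasCompactSupport hdc)
    (by simpa using hf.continuous.integrable_of_hasCompactSupport hc)
    (fun x _ ↦ differentiableAt_const _) (fun x _ ↦ (hf.differentiable one_ne_zero) x)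
  simpa using this

variable {n : ℕ} {M : Type*} [TopologicalSpace M] [ChartedSpace (EuclideanSpace ℝ (Fin n)) M]
  {X W N : M → Ambient n} {x : M} {V : Set (EuclideanSpace ℝ (Fin n))}
  {u : EuclideanSpace ℝ (Fin n)}

/-- The components `Wᵏ = σᵏʲ ⟨W, ∂X/∂uʲ⟩` of a tangential field. -/
def tangentialComponent (X W : M → Ambient n) (x : M) (k : Fin n)
    (u : EuclideanSpace ℝ (Fin n)) : ℝ :=
  ∑ j, (metricMatrix X x u)⁻¹ k j *
    inner ℝ (W ((chartAt (EuclideanSpace ℝ (Fin n)) x).symm u)) (coordDeriv X x u j)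

theorem contDiffOn_tangentialComponent (hV : IsOpen V)
    (hX : ContDiffOn ℝ ∞ (X ∘ (chartAt (EuclideanSpace ℝ (Fin n)) x).symm) V)
    (hW : ContDiffOn ℝ ∞ (W ∘ (chartAt (EuclideanSpace ℝ (Fin n)) x).symm) V)
    (hli : ∀ u ∈ V, LinearIndependent ℝ (coordDeriv X x u)) (k : Fin n) :
    ContDiffOn ℝ ∞ (tangentialComponent X W x k) V :=
  ContDiffOn.sum fun j _ ↦ (contDiffOn_metricMatrix_inv (X := fun _ ↦ X) (u := id)
    (contDiffOn_coordDeriv hV hX) hli k j).mul (hW.inner ℝ (contDiffOn_coordDeriv hV hX j))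

/-- The divergence of a tangential field in coordinates. -/
theorem sum_fderiv_sqrt_det_mul_tangentialComponent (hV : IsOpen V)
    (hX : ContDiffOn ℝ ∞ (X ∘ (chartAt (EuclideanSpace ℝ (Fin n)) x).symm) V)
    (hW : ContDiffOn ℝ ∞ (W ∘ (chartAt (EuclideanSpace ℝ (Fin n)) x).symm) V)
    (hli : ∀ u ∈ V, LinearIndependent ℝ (coordDeriv X x u))
    (hN : ∀ p, N p ≠ 0)
    (horth : ∀ u ∈ V, ∀ i, inner ℝ (N ((chartAt (EuclideanSpace ℝ (Fin n)) x).symm u))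
      (coordDeriv X x u i) = 0)
    (hWN : ∀ p, inner ℝ (W p) (N p) = 0) (hu : u ∈ V) :
    ∑ k, fderiv ℝ (fun u ↦ √(metricMatrix X x u).det * tangentialComponent X W x k u) u
      (EuclideanSpace.single k 1) = meanCurvatureIn X W x u * √(metricMatrix X x u).det := by
  have hXd := contDiffOn_coordDeriv hV hX
  have hdX : ∀ i, DifferentiableAt ℝ (fun u ↦ coordDeriv X x u i) u := fun i ↦
    differentiableAt_of_contDiffOn (hXd i) hV hu
  have hdsq : DifferentiableAt ℝ (fun u ↦ √(metricMatrix X x u).det) u :=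
    differentiableAt_of_contDiffOn (contDiffOn_sqrt_det_metricMatrix
      (X := fun _ ↦ X) (u := id) hXd hli) hV hu
  have hcd : ∀ k, DifferentiableAt ℝ (tangentialComponent X W x k) u := fun k ↦
    differentiableAt_of_contDiffOn (contDiffOn_tangentialComponent hV hX hW hli k) hV hu
  let G : Matrix (Fin n) (Fin n) ℝ := metricMatrix X x u
  let S : Matrix (Fin n) (Fin n) ℝ := G⁻¹
  let e : Fin n → EuclideanSpace ℝ (Fin n) := fun k ↦ EuclideanSpace.single k 1
  -- The Christoffel symbols of the first kind, `⟨∂ₖ∂ᵢX, ∂ⱼX⟩`.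
  let Γ : Fin n → Fin n → Fin n → ℝ := fun k i j ↦
    inner ℝ (fderiv ℝ (fun u ↦ coordDeriv X x u i) u (e k)) (coordDeriv X x u j)
  have hΓ : ∀ k i j, Γ k i j = Γ i k j := by
    intro k i j
    show inner ℝ _ _ = inner ℝ _ _
    congr 1
    exact fderiv_fderiv_comm hX hV hu _ _
  have hS : ∀ i j, S i j = S j i := fun i j ↦ congrFun (congrFun (gram_inv_transpose _) j) i
  have hSG : S * G = 1 :=
    Matrix.nonsing_inv_mul _ (isUnit_iff_ne_zero.2 (det_gram_pos (hli u hu)).ne')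
  have hsqrt : ∀ k, fderiv ℝ (fun u ↦ √(metricMatrix X x u).det) u (e k)
      = (∑ i, ∑ j, S i j * Γ k i j) * √(metricMatrix X x u).det := by
    intro k
    -- Restriction to the coordinate line through `u`, so that the one-variable formula for `√det`
    -- applies.
    have hline : ∀ {F : Type} [NormedAddCommGroup F] [NormedSpace ℝ F]
        {f : EuclideanSpace ℝ (Fin n) → F}, DifferentiableAt ℝ f u →
        HasDerivAt (fun t : ℝ ↦ f (u + t • e k)) (fderiv ℝ f u (e k)) 0 :=
      fun hf ↦ hf.hasFDerivAt.hasLineDerivAt (e k)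
    have hGd : ∀ i j, HasDerivAt (fun t : ℝ ↦ metricMatrix X x (u + t • e k) i j)
        ((Matrix.of fun i j ↦ Γ k j i + Γ k i j : Matrix (Fin n) (Fin n) ℝ) i j) 0 := by
      intro i j
      refine ((hline (hdX i)).inner ℝ (hline (hdX j))).congr_deriv ?_
      simp only [zero_smul, add_zero, Matrix.of_apply, Γ]
      rw [real_inner_comm]
    have h1 := hasDerivAt_sqrt_det hGd (by simpa [metricMatrix_eq_gram] using det_gram_pos (hli u hu))
    have h2 := hline hdsq
    rw [show fderiv ℝ (fun u ↦ √(metricMatrix X x u).det) u (e k) = _ from h2.unique h1]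
    simp only [zero_smul, add_zero]
    congr 1
    have h3 : ∑ i, ∑ j, S i j * Γ k j i = ∑ i, ∑ j, S i j * Γ k i j := by
      rw [Finset.sum_comm]
      exact Finset.sum_congr rfl fun i _ ↦ Finset.sum_congr rfl fun j _ ↦ by rw [hS]
    have h4 : ((metricMatrix X x u)⁻¹ * Matrix.of fun i j ↦ Γ k j i + Γ k i j).trace
        = ∑ i, ∑ j, S i j * Γ k j i + ∑ i, ∑ j, S i j * Γ k i j := by
      simp only [Matrix.trace, Matrix.diag_apply, Matrix.mul_apply, Matrix.of_apply, mul_add,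
        Finset.sum_add_distrib]
      rw [add_comm]
    rw [h4, h3]
    ring
  -- Tangency is used here: `W = Wˡ ∂ₗX` on a neighbourhood, so the expansion may be differentiated.
  have hWexp : (W ∘ (chartAt (EuclideanSpace ℝ (Fin n)) x).symm) =ᶠ[𝓝 u]
      fun u ↦ ∑ l, tangentialComponent X W x l u • coordDeriv X x u l := by
    filter_upwards [hV.mem_nhds hu] with u' hu'
    exact (tangentialPart_eq_self (hli u' hu') (hN _) (horth u' hu') (hWN _)).symm
  have hWd : ∀ i j, inner ℝ (coordDeriv W x u i) (coordDeriv X x u j)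
      = ∑ l, (fderiv ℝ (tangentialComponent X W x l) u (e i) * G l j
        + tangentialComponent X W x l u * Γ i l j) := by
    intro i j
    have : coordDeriv W x u i = ∑ l, (tangentialComponent X W x l u •
        fderiv ℝ (fun u ↦ coordDeriv X x u l) u (e i)
        + fderiv ℝ (tangentialComponent X W x l) u (e i) • coordDeriv X x u l) := by
      change fderiv ℝ (W ∘ _) u (e i) = _
      rw [hWexp.fderiv_eq, fderiv_fun_sum fun l _ ↦ (hcd l).fun_smul (hdX l),
        _root_.sum_apply]
      refine Finset.sum_congr rfl fun l _ ↦ ?_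
      rw [fderiv_fun_smul (hcd l) (hdX l)]
      rfl
    rw [this, sum_inner]
    refine Finset.sum_congr rfl fun l _ ↦ ?_
    rw [inner_add_left, inner_smul_left, inner_smul_left, add_comm]
    rfl
  have hprod : ∀ k, fderiv ℝ (fun u ↦ √(metricMatrix X x u).det * tangentialComponent X W x k u) u
      (e k) = (fderiv ℝ (tangentialComponent X W x k) u (e k)
        + tangentialComponent X W x k u * ∑ i, ∑ j, S i j * Γ k i j)
          * √(metricMatrix X x u).det := by
    intro k
    rw [fderiv_fun_mul hdsq (hcd k)]
    simp only [_root_.add_apply, _root_.smul_apply, smul_eq_mul]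
    rw [hsqrt]
    ring
  rw [Finset.sum_congr rfl fun k _ ↦ hprod k, ← Finset.sum_mul]
  congr 1
  have hmc : meanCurvatureIn X W x u = ∑ i, ∑ j, S i j *
      ∑ l, (fderiv ℝ (tangentialComponent X W x l) u (e i) * G l j
        + tangentialComponent X W x l u * Γ i l j) :=
    Finset.sum_congr rfl fun i _ ↦ Finset.sum_congr rfl fun j _ ↦ by rw [← hWd]; rfl
  have h5 : ∀ i, ∑ j, S i j * ∑ l, (fderiv ℝ (tangentialComponent X W x l) u (e i) * G l j)
      = fderiv ℝ (tangentialComponent X W x i) u (e i) := by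
    intro i
    simp_rw [Finset.mul_sum]
    rw [Finset.sum_comm]
    have : ∀ l, ∑ j, S i j * (fderiv ℝ (tangentialComponent X W x l) u (e i) * G l j)
        = fderiv ℝ (tangentialComponent X W x l) u (e i) * (1 : Matrix (Fin n) (Fin n) ℝ) i l := by
      intro l
      rw [← hSG, Matrix.mul_apply, Finset.mul_sum]
      refine Finset.sum_congr rfl fun j _ ↦ ?_
      rw [show G l j = G j l from congrFun (congrFun (gram_transpose _) j) l]
      ring
    rw [Finset.sum_congr rfl fun l _ ↦ this l]
    simp [Matrix.one_apply]
  rw [hmc]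
  simp_rw [Finset.sum_add_distrib, mul_add, Finset.sum_add_distrib, h5]
  congr 1
  simp_rw [Finset.mul_sum]
  rw [Finset.sum_comm]
  refine Finset.sum_congr rfl fun i _ ↦ ?_
  rw [Finset.sum_comm]
  refine Finset.sum_congr rfl fun j _ ↦ Finset.sum_congr rfl fun k _ ↦ ?_
  -- After cancelling `∂ᵢWⁱ`, the two sides contract `Γ i l j` and `Γ l i j` with `S i j`; these
  -- agree by symmetry in the first two indices.
  rw [hΓ]
  ring

/-- The divergence theorem for tangential fields with compact support in a chart. -/
theorem setIntegral_meanCurvatureIn_eq_zero (hV : IsOpen V)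
    (hX : ContDiffOn ℝ ∞ (X ∘ (chartAt (EuclideanSpace ℝ (Fin n)) x).symm) V)
    (hW : ContDiffOn ℝ ∞ (W ∘ (chartAt (EuclideanSpace ℝ (Fin n)) x).symm) V)
    (hli : ∀ u ∈ V, LinearIndependent ℝ (coordDeriv X x u))
    (hN : ∀ p, N p ≠ 0)
    (horth : ∀ u ∈ V, ∀ i, inner ℝ (N ((chartAt (EuclideanSpace ℝ (Fin n)) x).symm u))
      (coordDeriv X x u i) = 0)
    (hWN : ∀ p, inner ℝ (W p) (N p) = 0) {K : Set (EuclideanSpace ℝ (Fin n))}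
    (hK : IsCompact K) (hKV : K ⊆ V)
    (hWK : ∀ u ∈ V, u ∉ K → W ((chartAt (EuclideanSpace ℝ (Fin n)) x).symm u) = 0) :
    ∫ u in V, meanCurvatureIn X W x u * √(metricMatrix X x u).det = 0 := by
  -- Extension by zero off the chart; it remains smooth because `W` already vanishes on `V` outside
  -- the compact set `K`.
  let f : Fin n → EuclideanSpace ℝ (Fin n) → ℝ := fun k ↦
    V.indicator fun u ↦ √(metricMatrix X x u).det * tangentialComponent X W x k u
  have hfV : ∀ k, ∀ u ∈ V, f k =ᶠ[𝓝 u]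
      fun u ↦ √(metricMatrix X x u).det * tangentialComponent X W x k u := by
    intro k u hu
    filter_upwards [hV.mem_nhds hu] with u' hu'
    exact indicator_of_mem hu' _
  have hf0 : ∀ k, ∀ u ∉ K, f k u = 0 := by
    intro k u hu
    by_cases huV : u ∈ V
    · simp only [f, indicator_of_mem huV, tangentialComponent, hWK u huV hu, inner_zero_left,
        mul_zero, Finset.sum_const_zero]
    · exact indicator_of_notMem huV _
  have hfs : ∀ k, HasCompactSupport (f k) := fun k ↦ HasCompactSupport.intro hK (hf0 k)
  have hfd : ∀ k, ContDiff ℝ 1 (f k) := by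
    intro k
    rw [contDiff_iff_contDiffAt]
    intro u
    by_cases huV : u ∈ V
    · have h1 : ContDiffOn ℝ ∞ (fun u ↦ √(metricMatrix X x u).det
          * tangentialComponent X W x k u) V :=
        (contDiffOn_sqrt_det_metricMatrix (X := fun _ ↦ X) (u := id)
          (contDiffOn_coordDeriv hV hX) hli).mul
          (contDiffOn_tangentialComponent hV hX hW hli k)
      exact (((h1 u huV).contDiffAt (hV.mem_nhds huV)).of_le (by simp)).congr_of_eventuallyEq
        (hfV k u huV)
    · have h2 : f k =ᶠ[𝓝 u] fun _ ↦ 0 := by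
        filter_upwards [hK.isClosed.isOpen_compl.mem_nhds fun h ↦ huV (hKV h)] with u' hu'
        exact hf0 k u' hu'
      exact contDiffAt_const.congr_of_eventuallyEq h2
  have h0 : ∀ u ∉ V, ∀ k, fderiv ℝ (f k) u = 0 := by
    intro u huV k
    have h2 : f k =ᶠ[𝓝 u] fun _ ↦ 0 := by
      filter_upwards [hK.isClosed.isOpen_compl.mem_nhds fun h ↦ huV (hKV h)] with u' hu'
      exact hf0 k u' hu'
    rw [h2.fderiv_eq]
    simp
  have h3 : ∫ u in V, meanCurvatureIn X W x u * √(metricMatrix X x u).det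
      = ∫ u in V, ∑ k, fderiv ℝ (f k) u (EuclideanSpace.single k 1) := by
    refine setIntegral_congr_fun hV.measurableSet fun u hu ↦ ?_
    rw [← sum_fderiv_sqrt_det_mul_tangentialComponent hV hX hW hli hN horth hWN hu]
    exact Finset.sum_congr rfl fun k _ ↦ by rw [(hfV k u hu).fderiv_eq]
  rw [h3, setIntegral_eq_integral_of_forall_compl_eq_zero fun u hu ↦
    Finset.sum_eq_zero fun k _ ↦ by rw [h0 u hu k]; rfl, integral_finsetSum]
  · exact Finset.sum_eq_zero fun k _ ↦ integral_fderiv_apply_eq_zero volume (hfd k) (hfs k) _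
  · intro k _
    exact (((hfd k).continuous_fderiv one_ne_zero).clm_apply
      continuous_const).integrable_of_hasCompactSupport ((hfs k).fderiv_apply (𝕜 := ℝ) _)

end LocalDivergence

/-! ### Immersions in charts and changes of coordinates. -/

section Charts

variable {n : ℕ} {M : Type*} [TopologicalSpace M] [ChartedSpace (EuclideanSpace ℝ (Fin n)) M]

theorem contDiffOn_chartRep [IsManifold (𝓡 n) ∞ M] {J : Set ℝ} {F : Type*}
    [NormedAddCommGroup F] [NormedSpace ℝ F] {X : ℝ → M → F}
    (hX : ContMDiffOn (𝓘(ℝ, ℝ).prod (𝓡 n)) 𝓘(ℝ, F) ∞ (fun q : ℝ × M ↦ X q.1 q.2) (J ×ˢ univ))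
    (x : M) :
    ContDiffOn ℝ ∞ (chartRep X x) (J ×ˢ (chartAt (EuclideanSpace ℝ (Fin n)) x).target) := by
  rw [← contMDiffOn_iff_contDiffOn]
  have h1 : ContMDiffOn 𝓘(ℝ, ℝ × EuclideanSpace ℝ (Fin n)) (𝓘(ℝ, ℝ).prod (𝓡 n)) ∞
      (fun q : ℝ × EuclideanSpace ℝ (Fin n) ↦
        (q.1, (chartAt (EuclideanSpace ℝ (Fin n)) x).symm q.2))
      (J ×ˢ (chartAt (EuclideanSpace ℝ (Fin n)) x).target) :=
    contDiff_fst.contMDiff.contMDiffOn.prodMk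
      ((contMDiffOn_chart_symm (I := 𝓡 n)).comp contDiff_snd.contMDiff.contMDiffOn
        fun q hq ↦ hq.2)
  exact hX.comp h1 fun q hq ↦ ⟨hq.1, mem_univ _⟩

theorem contDiffOn_comp_chartAt_symm [IsManifold (𝓡 n) ∞ M] {F : Type*}
    [NormedAddCommGroup F] [NormedSpace ℝ F] {f : M → F}
    (hf : ContMDiff (𝓡 n) 𝓘(ℝ, F) ∞ f) (x : M) :
    ContDiffOn ℝ ∞ (f ∘ (chartAt (EuclideanSpace ℝ (Fin n)) x).symm)
      (chartAt (EuclideanSpace ℝ (Fin n)) x).target := by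
  rw [← contMDiffOn_iff_contDiffOn]
  exact hf.comp_contMDiffOn (contMDiffOn_chart_symm (I := 𝓡 n))

/-- The change of coordinates from the chart attached to `x` to the chart attached to `y`. -/
theorem contDiffOn_chart_change [IsManifold (𝓡 n) ∞ M] (x y : M) :
    ContDiffOn ℝ ∞ (chartAt (EuclideanSpace ℝ (Fin n)) y ∘
        (chartAt (EuclideanSpace ℝ (Fin n)) x).symm)
      ((chartAt (EuclideanSpace ℝ (Fin n)) x).target ∩
        (chartAt (EuclideanSpace ℝ (Fin n)) x).symm ⁻¹'
          (chartAt (EuclideanSpace ℝ (Fin n)) y).source) := by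
  rw [← contMDiffOn_iff_contDiffOn]
  exact (contMDiffOn_chart (I := 𝓡 n)).comp
    ((contMDiffOn_chart_symm (I := 𝓡 n)).mono inter_subset_left) fun _ hu ↦ hu.2

/-- The coordinate derivatives of an immersion are linearly independent. -/
theorem linearIndependent_coordDeriv [IsManifold (𝓡 n) ∞ M] {X : M → Ambient n}
    (hX : Manifold.IsImmersion (𝓡 n) 𝓘(ℝ, Ambient n) ∞ X) {x : M}
    {u : EuclideanSpace ℝ (Fin n)} (hu : u ∈ (chartAt (EuclideanSpace ℝ (Fin n)) x).target) :
    LinearIndependent ℝ (coordDeriv X x u) := by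
  set c := chartAt (EuclideanSpace ℝ (Fin n)) x
  set p := c.symm u
  have hp := hX.isImmersionAt p
  -- In the normal form of an immersion `X` is `w ↦ (w, 0)`, so the first component undoes it.
  let L : Ambient n → EuclideanSpace ℝ (Fin n) := fun z ↦ (hp.equiv.symm z).1
  have hL : ContDiff ℝ ∞ L := contDiff_fst.comp hp.equiv.symm.contDiff
  have hpc : p ∈ c.source := c.map_target hu
  have hleft : ∀ q ∈ hp.domChart.source, L (hp.codChart (X q)) = hp.domChart q := by
    intro q hq
    have h1 := hp.writtenInCharts (show hp.domChart q ∈ (hp.domChart.extend (𝓡 n)).target by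
      simpa using hp.domChart.map_source hq)
    simp only [Function.comp_apply, mfld_simps, hp.domChart.left_inv hq] at h1
    simp only [L, h1, ContinuousLinearEquiv.symm_apply_apply]
  have hdom : hp.domChart ∈ IsManifold.maximalAtlas (𝓡 n) ∞ M := hp.domChart_mem_maximalAtlas
  have hcod := hp.codChart_mem_maximalAtlas
  -- A smooth local left inverse of `X` in the chart `c`; by the chain rule the derivative of `X ∘
  -- c.symm` is injective.
  let g : Ambient n → EuclideanSpace ℝ (Fin n) := fun z ↦
    c (hp.domChart.symm (L (hp.codChart z)))
  have hg : ContMDiffAt 𝓘(ℝ, Ambient n) (𝓡 n) ∞ g (X p) := by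
    have e0 := hleft p hp.mem_domChart_source
    have h1 : ContMDiffAt 𝓘(ℝ, Ambient n) 𝓘(ℝ, Ambient n) ∞ hp.codChart (X p) :=
      contMDiffAt_of_mem_maximalAtlas hcod hp.mem_codChart_source
    have h2 : ContMDiffAt 𝓘(ℝ, Ambient n) (𝓡 n) ∞ (fun z ↦ L (hp.codChart z)) (X p) :=
      (hL.contMDiff.contMDiffAt).comp (X p) h1
    have h3 : ContMDiffAt 𝓘(ℝ, Ambient n) (𝓡 n) ∞
        (fun z ↦ hp.domChart.symm (L (hp.codChart z))) (X p) := by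
      refine ContMDiffAt.comp (X p) (g := hp.domChart.symm) ?_ h2
      rw [e0]
      exact contMDiffAt_symm_of_mem_maximalAtlas hdom (hp.domChart.map_source hp.mem_domChart_source)
    refine ContMDiffAt.comp (X p) (g := c) ?_ h3
    rw [e0, hp.domChart.left_inv hp.mem_domChart_source]
    exact (contMDiffOn_chart (I := 𝓡 n)).contMDiffAt (c.open_source.mem_nhds hpc)
  have hgd : DifferentiableAt ℝ g (X p) := hg.contDiffAt.differentiableAt (by simp)
  have hXd : DifferentiableAt ℝ (X ∘ c.symm) u :=
    differentiableAt_of_contDiffOn (contDiffOn_comp_chartAt_symm hX.contMDiff x) c.open_target hu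
  have hid : g ∘ (X ∘ c.symm) =ᶠ[𝓝 u] id := by
    have h1 : ∀ᶠ u' in 𝓝 u, c.symm u' ∈ hp.domChart.source :=
      (c.continuousAt_symm hu).preimage_mem_nhds
        (hp.domChart.open_source.mem_nhds hp.mem_domChart_source)
    filter_upwards [h1, c.open_target.mem_nhds hu] with u' hu' hu''
    simp only [Function.comp_apply, g, hleft _ hu', hp.domChart.left_inv hu', c.right_inv hu'', id]
  have hcomp : (fderiv ℝ g (X p)).comp (fderiv ℝ (X ∘ c.symm) u) = ContinuousLinearMap.id ℝ _ := by
    have h1 : fderiv ℝ (g ∘ (X ∘ c.symm)) u = _ := fderiv_comp u hgd hXd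
    rw [← fderiv_id (𝕜 := ℝ) (x := u), ← hid.fderiv_eq, h1]
    rfl
  have hinj : Function.Injective (fderiv ℝ (X ∘ c.symm) u) := by
    refine Function.LeftInverse.injective (g := fderiv ℝ g (X p)) fun w ↦ ?_
    exact congrArg (fun T : EuclideanSpace ℝ (Fin n) →L[ℝ] EuclideanSpace ℝ (Fin n) ↦ T w) hcomp
  have hbasis : LinearIndependent ℝ fun i : Fin n ↦ (EuclideanSpace.single i (1 : ℝ)) := by
    have h1 := (EuclideanSpace.basisFun (Fin n) ℝ).orthonormal.linearIndependent
    rwa [show ⇑(EuclideanSpace.basisFun (Fin n) ℝ) = fun i ↦ EuclideanSpace.single i (1 : ℝ) from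
      funext fun i ↦ EuclideanSpace.basisFun_apply _ _ i] at h1
  exact hbasis.map' (fderiv ℝ (X ∘ c.symm) u).toLinearMap (LinearMap.ker_eq_bot.2 hinj)

section Change

variable [IsManifold (𝓡 n) ∞ M] {x y : M} {u : EuclideanSpace ℝ (Fin n)}

/-- The Jacobian of the change of coordinates between two charts. -/
def jacobian (x y : M) (u : EuclideanSpace ℝ (Fin n)) :
    EuclideanSpace ℝ (Fin n) →L[ℝ] EuclideanSpace ℝ (Fin n) :=
  fderiv ℝ (chartAt (EuclideanSpace ℝ (Fin n)) y ∘
    (chartAt (EuclideanSpace ℝ (Fin n)) x).symm) u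

/-- The Jacobian matrix of the change of coordinates between two charts. -/
def jacobianMatrix (x y : M) (u : EuclideanSpace ℝ (Fin n)) : Matrix (Fin n) (Fin n) ℝ :=
  Matrix.of fun j i ↦ jacobian x y u (EuclideanSpace.single i 1) j

omit [IsManifold (𝓡 n) ∞ M] in
theorem det_jacobianMatrix (x y : M) (u : EuclideanSpace ℝ (Fin n)) :
    (jacobianMatrix x y u).det = (jacobian x y u).det := by
  rw [ContinuousLinearMap.det, ← LinearMap.det_toMatrix (EuclideanSpace.basisFun (Fin n) ℝ).toBasis]
  rfl

variable (hu : u ∈ (chartAt (EuclideanSpace ℝ (Fin n)) x).target)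
  (huy : (chartAt (EuclideanSpace ℝ (Fin n)) x).symm u ∈
    (chartAt (EuclideanSpace ℝ (Fin n)) y).source)

omit [IsManifold (𝓡 n) ∞ M] in
theorem isOpen_overlap (x y : M) : IsOpen ((chartAt (EuclideanSpace ℝ (Fin n)) x).target ∩
    (chartAt (EuclideanSpace ℝ (Fin n)) x).symm ⁻¹'
      (chartAt (EuclideanSpace ℝ (Fin n)) y).source) :=
  (chartAt (EuclideanSpace ℝ (Fin n)) x).isOpen_inter_preimage_symm
    (chartAt (EuclideanSpace ℝ (Fin n)) y).open_source

include hu huy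

theorem coordDeriv_change {F : M → Ambient n}
    (hF : DifferentiableAt ℝ (F ∘ (chartAt (EuclideanSpace ℝ (Fin n)) y).symm)
      (chartAt (EuclideanSpace ℝ (Fin n)) y ((chartAt (EuclideanSpace ℝ (Fin n)) x).symm u)))
    (i : Fin n) :
    coordDeriv F x u i = ∑ j, jacobianMatrix x y u j i •
      coordDeriv F y (chartAt (EuclideanSpace ℝ (Fin n)) y
        ((chartAt (EuclideanSpace ℝ (Fin n)) x).symm u)) j := by
  set cx := chartAt (EuclideanSpace ℝ (Fin n)) x
  set cy := chartAt (EuclideanSpace ℝ (Fin n)) y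
  have hd : DifferentiableAt ℝ (cy ∘ cx.symm) u :=
    differentiableAt_of_contDiffOn (contDiffOn_chart_change x y) (isOpen_overlap x y) ⟨hu, huy⟩
  have hev : F ∘ cx.symm =ᶠ[𝓝 u] (F ∘ cy.symm) ∘ (cy ∘ cx.symm) := by
    filter_upwards [(isOpen_overlap x y).mem_nhds ⟨hu, huy⟩] with u' hu'
    simp only [Function.comp_apply]
    rw [cy.left_inv hu'.2]
  have h1 : coordDeriv F x u i = fderiv ℝ (F ∘ cy.symm) (cy (cx.symm u))
      (jacobian x y u (EuclideanSpace.single i 1)) := by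
    change fderiv ℝ (F ∘ cx.symm) u _ = _
    rw [hev.fderiv_eq, fderiv_comp u hF hd]
    rfl
  have h2 : jacobian x y u (EuclideanSpace.single i 1)
      = ∑ j, jacobianMatrix x y u j i • EuclideanSpace.single j (1 : ℝ) := by
    conv_lhs => rw [← (EuclideanSpace.basisFun (Fin n) ℝ).sum_repr
      (jacobian x y u (EuclideanSpace.single i 1))]
    simp [jacobianMatrix]
  rw [h1, h2, map_sum]
  exact Finset.sum_congr rfl fun j _ ↦ map_smul _ _ _

omit hu huy in
theorem inner_sum_smul_sum_smul {A : Matrix (Fin n) (Fin n) ℝ} (a b : Fin n → Ambient n)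
    (i j : Fin n) :
    inner ℝ (∑ k, A k i • a k) (∑ l, A l j • b l)
      = (A.transpose * (Matrix.of fun k l ↦ inner ℝ (a k) (b l)) * A) i j := by
  rw [inner_sum]
  rw [Matrix.mul_apply]
  refine Finset.sum_congr rfl fun l _ ↦ ?_
  rw [inner_smul_right, sum_inner, Matrix.mul_apply, mul_comm]
  congr 1
  refine Finset.sum_congr rfl fun k _ ↦ ?_
  rw [inner_smul_left]
  rfl

theorem sffMatrix_change {X W : M → Ambient n}
    (hX : DifferentiableAt ℝ (X ∘ (chartAt (EuclideanSpace ℝ (Fin n)) y).symm)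
      (chartAt (EuclideanSpace ℝ (Fin n)) y ((chartAt (EuclideanSpace ℝ (Fin n)) x).symm u)))
    (hW : DifferentiableAt ℝ (W ∘ (chartAt (EuclideanSpace ℝ (Fin n)) y).symm)
      (chartAt (EuclideanSpace ℝ (Fin n)) y ((chartAt (EuclideanSpace ℝ (Fin n)) x).symm u))) :
    sffMatrix X W x u = (jacobianMatrix x y u).transpose * sffMatrix X W y
      (chartAt (EuclideanSpace ℝ (Fin n)) y ((chartAt (EuclideanSpace ℝ (Fin n)) x).symm u))
      * jacobianMatrix x y u := by
  ext i j
  rw [sffMatrix, Matrix.of_apply, coordDeriv_change hu huy hX, coordDeriv_change hu huy hW, inner_sum_smul_sum_smul]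
  rfl

theorem metricMatrix_change {X : M → Ambient n}
    (hX : DifferentiableAt ℝ (X ∘ (chartAt (EuclideanSpace ℝ (Fin n)) y).symm)
      (chartAt (EuclideanSpace ℝ (Fin n)) y ((chartAt (EuclideanSpace ℝ (Fin n)) x).symm u))) :
    metricMatrix X x u = (jacobianMatrix x y u).transpose * metricMatrix X y
      (chartAt (EuclideanSpace ℝ (Fin n)) y ((chartAt (EuclideanSpace ℝ (Fin n)) x).symm u))
      * jacobianMatrix x y u :=
  sffMatrix_change hu huy hX hX

/-- From `det(Aᵀ G A) = (det A)² det G`: the volume density picks up exactly the Jacobian factor of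
the change of variables formula. -/
theorem sqrt_det_metricMatrix_change {X : M → Ambient n}
    (hX : DifferentiableAt ℝ (X ∘ (chartAt (EuclideanSpace ℝ (Fin n)) y).symm)
      (chartAt (EuclideanSpace ℝ (Fin n)) y ((chartAt (EuclideanSpace ℝ (Fin n)) x).symm u))) :
    √(metricMatrix X x u).det = |(jacobian x y u).det| * √(metricMatrix X y
      (chartAt (EuclideanSpace ℝ (Fin n)) y
        ((chartAt (EuclideanSpace ℝ (Fin n)) x).symm u))).det := by
  rw [metricMatrix_change hu huy hX, Matrix.det_mul, Matrix.det_mul, Matrix.det_transpose,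
    det_jacobianMatrix, mul_right_comm, ← sq, Real.sqrt_mul (sq_nonneg _), Real.sqrt_sq_eq_abs]

theorem det_jacobianMatrix_ne_zero {X : M → Ambient n}
    (hX : DifferentiableAt ℝ (X ∘ (chartAt (EuclideanSpace ℝ (Fin n)) y).symm)
      (chartAt (EuclideanSpace ℝ (Fin n)) y ((chartAt (EuclideanSpace ℝ (Fin n)) x).symm u)))
    (hli : LinearIndependent ℝ (coordDeriv X x u)) : (jacobianMatrix x y u).det ≠ 0 := by
  have h := (det_gram_pos hli).ne'
  rw [← metricMatrix_eq_gram, metricMatrix_change hu huy hX, Matrix.det_mul] at h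
  exact right_ne_zero_of_mul h

/-- Metric and second form both transform as `Aᵀ · A`, so the matrix `σ⁻¹ hᵀ` is conjugated by `A`
and its trace is unchanged. -/
theorem meanCurvatureIn_change {X W : M → Ambient n}
    (hX : DifferentiableAt ℝ (X ∘ (chartAt (EuclideanSpace ℝ (Fin n)) y).symm)
      (chartAt (EuclideanSpace ℝ (Fin n)) y ((chartAt (EuclideanSpace ℝ (Fin n)) x).symm u)))
    (hW : DifferentiableAt ℝ (W ∘ (chartAt (EuclideanSpace ℝ (Fin n)) y).symm)
      (chartAt (EuclideanSpace ℝ (Fin n)) y ((chartAt (EuclideanSpace ℝ (Fin n)) x).symm u)))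
    (hli : LinearIndependent ℝ (coordDeriv X x u)) :
    meanCurvatureIn X W x u = meanCurvatureIn X W y (chartAt (EuclideanSpace ℝ (Fin n)) y
      ((chartAt (EuclideanSpace ℝ (Fin n)) x).symm u)) := by
  have hA := isUnit_iff_ne_zero.2 (det_jacobianMatrix_ne_zero hu huy hX hli)
  have htr : ∀ A C : Matrix (Fin n) (Fin n) ℝ, ∑ i, ∑ j, A i j * C i j
      = (A * C.transpose).trace := by
    intro A C
    simp [Matrix.trace, Matrix.mul_apply]
  rw [meanCurvatureIn, meanCurvatureIn, htr, htr, metricMatrix_change hu huy hX,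
    sffMatrix_change hu huy hX hW]
  set A := jacobianMatrix x y u
  simp only [Matrix.mul_inv_rev, Matrix.transpose_mul, Matrix.transpose_transpose]
  have hAt : IsUnit A.transpose.det := by rwa [Matrix.det_transpose]
  rw [mul_assoc, mul_assoc, Matrix.trace_mul_comm, Matrix.nonsing_inv_mul_cancel_left _ _ hAt]
  rw [mul_assoc, mul_assoc, Matrix.mul_nonsing_inv _ hA, mul_one]

/-- The Jacobian `A` does not depend on the parameter, so `δσ` also transforms as `Aᵀ · A`, while
the contravariant factor transforms as `A⁻¹ · (Aᵀ)⁻¹`. -/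
theorem variationDensityIn_change {X ν : ℝ → M → Ambient n} {s : ℝ}
    (hX : ∀ᶠ t in 𝓝 s, DifferentiableAt ℝ (X t ∘ (chartAt (EuclideanSpace ℝ (Fin n)) y).symm)
      (chartAt (EuclideanSpace ℝ (Fin n)) y ((chartAt (EuclideanSpace ℝ (Fin n)) x).symm u)))
    (hν : DifferentiableAt ℝ (ν s ∘ (chartAt (EuclideanSpace ℝ (Fin n)) y).symm)
      (chartAt (EuclideanSpace ℝ (Fin n)) y ((chartAt (EuclideanSpace ℝ (Fin n)) x).symm u)))
    (hσ : ∀ i j, DifferentiableAt ℝ (fun t ↦ metricMatrix (X t) y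
      (chartAt (EuclideanSpace ℝ (Fin n)) y
        ((chartAt (EuclideanSpace ℝ (Fin n)) x).symm u)) i j) s)
    (hli : LinearIndependent ℝ (coordDeriv (X s) x u)) :
    variationDensityIn X ν s x u = variationDensityIn X ν s y
      (chartAt (EuclideanSpace ℝ (Fin n)) y
        ((chartAt (EuclideanSpace ℝ (Fin n)) x).symm u)) := by
  have hXs := hX.self_of_nhds
  have hA := isUnit_iff_ne_zero.2 (det_jacobianMatrix_ne_zero hu huy hXs hli)
  set v := chartAt (EuclideanSpace ℝ (Fin n)) y ((chartAt (EuclideanSpace ℝ (Fin n)) x).symm u)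
  have hexp : ∀ (z : M) (w : EuclideanSpace ℝ (Fin n)) (D : Matrix (Fin n) (Fin n) ℝ),
      (∀ i j, deriv (fun t ↦ metricMatrix (X t) z w i j) s = D i j) →
      variationDensityIn X ν s z w = ((meanCurvatureIn (X s) (ν s) z w • (metricMatrix (X s) z w)⁻¹
        - (metricMatrix (X s) z w)⁻¹ * sffMatrix (X s) (ν s) z w * (metricMatrix (X s) z w)⁻¹)
        * D.transpose).trace := by
    intro z w D hD
    simp only [variationDensityIn, Matrix.trace, Matrix.diag_apply, Matrix.mul_apply,
      Matrix.transpose_apply, hD]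
    refine Finset.sum_congr rfl fun i _ ↦ Finset.sum_congr rfl fun j _ ↦ ?_
    congr 1
    rw [Matrix.sub_apply, Matrix.smul_apply, smul_eq_mul, Matrix.mul_apply, Finset.sum_comm]
    congr 1
    refine Finset.sum_congr rfl fun l _ ↦ ?_
    rw [Matrix.mul_apply, Finset.sum_mul]
    refine Finset.sum_congr rfl fun k _ ↦ ?_
    rw [show (metricMatrix (X s) z w)⁻¹ l j = (metricMatrix (X s) z w)⁻¹ j l from
      congrFun (congrFun (gram_inv_transpose _) j) l]
    ring
  let D : Matrix (Fin n) (Fin n) ℝ :=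
    Matrix.of fun i j ↦ deriv (fun t ↦ metricMatrix (X t) y v i j) s
  set A := jacobianMatrix x y u with hAdef
  have hD : ∀ i j, deriv (fun t ↦ metricMatrix (X t) x u i j) s = (A.transpose * D * A) i j := by
    intro i j
    have h1 : HasDerivAt (fun t ↦ (A.transpose * metricMatrix (X t) y v * A) i j)
        ((A.transpose * D * A) i j) s := by
      simp only [Matrix.mul_apply]
      exact HasDerivAt.fun_sum fun k _ ↦ HasDerivAt.mul_const (HasDerivAt.fun_sum fun l _ ↦
        HasDerivAt.const_mul _ (hσ l k).hasDerivAt) _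
    refine (h1.congr_of_eventuallyEq ?_).deriv
    filter_upwards [hX] with t ht
    rw [metricMatrix_change hu huy ht]
  rw [hexp x u _ hD, hexp y v D fun _ _ ↦ rfl, meanCurvatureIn_change hu huy hXs hν hli,
    metricMatrix_change hu huy hXs, sffMatrix_change hu huy hXs hν]
  have hAt : IsUnit A.transpose.det := by rwa [Matrix.det_transpose]
  rw [← hAdef]
  set G := (metricMatrix (X s) y v)
  set h := (sffMatrix (X s) (ν s) y v)
  simp only [Matrix.mul_inv_rev, Matrix.transpose_mul, Matrix.transpose_transpose]
  have hfac : (meanCurvatureIn (X s) (ν s) y v) • (A⁻¹ * (G⁻¹ * A.transpose⁻¹))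
      - A⁻¹ * (G⁻¹ * A.transpose⁻¹) * (A.transpose * h * A) * (A⁻¹ * (G⁻¹ * A.transpose⁻¹))
      = A⁻¹ * ((meanCurvatureIn (X s) (ν s) y v) • G⁻¹ - G⁻¹ * h * G⁻¹) * A.transpose⁻¹ := by
    rw [mul_sub, sub_mul]
    congr 1
    · simp only [Matrix.mul_smul, Matrix.smul_mul, mul_assoc]
    · simp only [mul_assoc]
      rw [Matrix.nonsing_inv_mul_cancel_left _ _ hAt, Matrix.mul_nonsing_inv_cancel_left _ _ hA]
  rw [hfac, mul_assoc, mul_assoc, Matrix.trace_mul_comm,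
    Matrix.nonsing_inv_mul_cancel_left _ _ hAt]
  rw [mul_assoc _ _ A⁻¹, mul_assoc _ A A⁻¹, Matrix.mul_nonsing_inv _ hA, mul_one, mul_assoc]

end Change

end Charts

/-! ### Stability of the unbounded side. -/

section Topological

variable {n : ℕ} {M : Type*} [TopologicalSpace M]

/-- A point in an unbounded component of the complement of a compact hypersurface stays in an
unbounded component when the point and the hypersurface are slightly moved. -/
theorem eventually_not_isBounded_connectedComponentIn {E : Type*} [NormedAddCommGroup E]
    [NormedSpace ℝ E] {X : ℝ → M → E} {s₀ : ℝ} {C : Set M} (hC : IsCompact C)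
    (hX : ∀ p, ContinuousAt (fun q : ℝ × M ↦ X q.1 q.2) (s₀, p)) {y₀ : E}
    (hy₀ : y₀ ∉ X s₀ '' C) (hunb : ¬ IsBounded (connectedComponentIn (X s₀ '' C)ᶜ y₀)) :
    ∀ᶠ r : ℝ × E in 𝓝 (s₀, y₀), ¬ IsBounded (connectedComponentIn (X r.1 '' C)ᶜ r.2) := by
  have hXs : Continuous (X s₀) := continuous_iff_continuousAt.2 fun p ↦
    ContinuousAt.comp (f := fun p ↦ (s₀, p)) (hX p) (Continuous.prodMk_right s₀).continuousAt
  have hopen : IsOpen (X s₀ '' C)ᶜ := (hC.image hXs).isClosed.isOpen_compl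
  obtain ⟨R, hR⟩ := (hC.image hXs).isBounded.subset_ball (0 : E)
  have hRs : ∀ᶠ s in 𝓝 s₀, ∀ p ∈ C, ‖X s p‖ < R := by
    refine hC.eventually_forall_of_forall_eventually fun p hp ↦ ?_
    have := hR (mem_image_of_mem _ hp)
    rw [mem_ball_zero_iff] at this
    exact (hX p).norm.eventually_lt continuousAt_const this
  -- A point of the component beyond the ball containing the hypersurface. Positivity is asked
  -- separately, as `R` may be negative when `C` is empty, and the ray through `z` has to be
  -- unbounded.
  obtain ⟨z, hz, hzR⟩ : ∃ z ∈ connectedComponentIn (X s₀ '' C)ᶜ y₀, R < ‖z‖ ∧ 0 < ‖z‖ := by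
    by_contra! h
    refine hunb ((Metric.isBounded_closedBall (x := (0 : E)) (r := max R 0)).subset fun z hz ↦ ?_)
    rw [mem_closedBall_zero_iff]
    rcases le_or_gt ‖z‖ R with h1 | h1
    · exact h1.trans (le_max_left _ _)
    · exact (h z hz h1).trans (le_max_right _ _)
  have hconn : IsConnected (connectedComponentIn (X s₀ '' C)ᶜ y₀) :=
    isConnected_connectedComponentIn_iff.2 hy₀
  have hpath : IsPathConnected (connectedComponentIn (X s₀ '' C)ᶜ y₀) :=
    (hopen.connectedComponentIn).isConnected_iff_isPathConnected.1 hconn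
  obtain ⟨γ, hγ⟩ := hpath.joinedIn y₀ (mem_connectedComponentIn hy₀) z hz
  obtain ⟨r, hr, hball⟩ := Metric.isOpen_iff.1 hopen y₀ hy₀
  -- The path from `y₀` to `z` and `C` are compact, so the moved hypersurface still misses the whole
  -- path.
  have havoid : ∀ᶠ s in 𝓝 s₀, ∀ a ∈ range γ ×ˢ C, X s a.2 ≠ a.1 := by
    refine ((isCompact_range γ.continuous).prod hC).eventually_forall_of_forall_eventually
      fun a ha ↦ ?_
    have h1 : X s₀ a.2 ≠ a.1 := by
      obtain ⟨⟨t, ht⟩, hp⟩ := ha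
      intro h
      exact connectedComponentIn_subset _ _ (hγ t) ⟨a.2, hp, by rw [h, ← ht]⟩
    have h2 : ContinuousAt (fun b : ℝ × (E × M) ↦ X b.1 b.2.2) (s₀, a) :=
      ContinuousAt.comp (g := fun q : ℝ × M ↦ X q.1 q.2) (x := (s₀, a))
        (f := fun b : ℝ × (E × M) ↦ (b.1, b.2.2)) (hX a.2) (by fun_prop)
    have h3 : ContinuousAt (fun b : ℝ × (E × M) ↦ b.2.1) (s₀, a) := by fun_prop
    exact ((h2.sub h3).eventually_ne (sub_ne_zero.2 h1)).mono fun _ ↦ sub_ne_zero.1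
  have hdist : ∃ r > 0, ∀ᶠ s in 𝓝 s₀, ∀ p ∈ C, X s p ∉ Metric.ball y₀ r := by
    refine ⟨r / 2, by positivity, ?_⟩
    refine hC.eventually_forall_of_forall_eventually fun p hp ↦ ?_
    have h1 : r / 2 < dist (X s₀ p) y₀ := by
      by_contra! h
      exact hball (show X s₀ p ∈ Metric.ball y₀ r from lt_of_le_of_lt h (by linarith))
        (mem_image_of_mem _ hp)
    filter_upwards [continuousAt_const.eventually_lt ((hX p).dist continuousAt_const) h1] with b hb
    rw [Metric.mem_ball, not_lt]
    exact hb.le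
  obtain ⟨r', hr', hdist⟩ := hdist
  rw [nhds_prod_eq]
  refine ((hRs.and (havoid.and hdist)).prod_mk (Metric.ball_mem_nhds y₀ hr')).mono ?_
  rintro ⟨s, y⟩ ⟨⟨h1, h2, h3⟩, hy⟩ hb
  simp only at h1 h2 h3 hy hb
  -- Ball around `y₀`, path to `z`, ray from `z` to infinity: a connected unbounded set in the
  -- complement.
  let T : Set E := (Metric.ball y₀ r' ∪ range γ) ∪ ((fun c : ℝ ↦ c • z) '' Ici 1)
  have hray : IsPreconnected ((fun c : ℝ ↦ c • z) '' Ici 1) :=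
    isPreconnected_Ici.image _ (by fun_prop)
  have hT : IsPreconnected T := by
    refine IsPreconnected.union z (Or.inr ⟨1, by simp⟩) ⟨1, by simp, by simp⟩ ?_ hray
    exact IsPreconnected.union y₀ (Metric.mem_ball_self hr') ⟨0, by simp⟩
      (convex_ball y₀ r').isPreconnected (isPreconnected_range γ.continuous)
  have hTs : T ⊆ (X s '' C)ᶜ := by
    rintro a ha ⟨p, hp, rfl⟩
    rcases ha with (ha | ha) | ⟨c, hc, hcz⟩
    · exact h3 p hp ha
    · exact h2 (X s p, p) ⟨ha, hp⟩ rfl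
    · have h4 := h1 p hp
      rw [← hcz, norm_smul, Real.norm_of_nonneg (zero_le_one.trans hc)] at h4
      have : 1 ≤ c := hc
      nlinarith [hzR.1, hzR.2]
  have hsub := hT.subset_connectedComponentIn (Or.inl (Or.inl hy)) hTs
  obtain ⟨B, hB⟩ := (hb.subset hsub).exists_norm_le
  -- This point of the ray has norm `|B| + ‖z‖`, exceeding the supposed bound `B`.
  have h5 := hB ((|B| / ‖z‖ + 1) • z) (Or.inr ⟨|B| / ‖z‖ + 1, by simp; positivity, rfl⟩)
  have h6 : 0 ≤ |B| / ‖z‖ := by positivity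
  rw [norm_smul, Real.norm_of_nonneg (by linarith), add_mul, div_mul_cancel₀ _ hzR.2.ne'] at h5
  linarith [le_abs_self B, hzR.2]

end Topological

/-! ### Smoothness of the outward unit normal. -/

section Normal

variable {n : ℕ} {M : Type*} [TopologicalSpace M] [ChartedSpace (EuclideanSpace ℝ (Fin n)) M]
  [IsManifold (𝓡 n) ∞ M]

/-- Translates the intrinsic conditions in `IsOutwardUnitNormal` and `IsIsometric` into coordinates.
-/
theorem coordDeriv_eq_mfderiv {X : M → Ambient n} (hX : ContMDiff (𝓡 n) 𝓘(ℝ, Ambient n) ∞ X)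
    {x : M} {u : EuclideanSpace ℝ (Fin n)}
    (hu : u ∈ (chartAt (EuclideanSpace ℝ (Fin n)) x).target) (i : Fin n) :
    coordDeriv X x u i = mfderiv (𝓡 n) 𝓘(ℝ, Ambient n) X
      ((chartAt (EuclideanSpace ℝ (Fin n)) x).symm u)
      (mfderiv (𝓡 n) (𝓡 n) (chartAt (EuclideanSpace ℝ (Fin n)) x).symm u
        (EuclideanSpace.single i (1 : ℝ))) := by
  set c := chartAt (EuclideanSpace ℝ (Fin n)) x
  have h1 : MDifferentiableAt (𝓡 n) (𝓡 n) c.symm u :=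
    ((contMDiffOn_chart_symm (I := 𝓡 n) (n := ∞)).contMDiffAt
      (c.open_target.mem_nhds hu)).mdifferentiableAt (by simp)
  have h2 : MDifferentiableAt (𝓡 n) 𝓘(ℝ, Ambient n) X (c.symm u) :=
    (hX _).mdifferentiableAt (by simp)
  have h3 := mfderiv_comp u h2 h1
  rw [mfderiv_eq_fderiv] at h3
  change fderiv ℝ (X ∘ c.symm) u (EuclideanSpace.single i (1 : ℝ)) = _
  rw [h3]
  rfl

theorem inner_normal_coordDeriv {X ν : M → Ambient n}
    (hX : ContMDiff (𝓡 n) 𝓘(ℝ, Ambient n) ∞ X) (hν : IsOutwardUnitNormal X ν) {x : M}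
    {u : EuclideanSpace ℝ (Fin n)} (hu : u ∈ (chartAt (EuclideanSpace ℝ (Fin n)) x).target)
    (i : Fin n) :
    inner ℝ (ν ((chartAt (EuclideanSpace ℝ (Fin n)) x).symm u)) (coordDeriv X x u i) = 0 := by
  rw [coordDeriv_eq_mfderiv hX hu]
  exact hν.orthogonal _ _

variable [CompactSpace M] {J : Set ℝ} {X ν : ℝ → M → Ambient n}

omit [CompactSpace M] [IsManifold (𝓡 n) ∞ M] in
theorem continuousAt_of_isSmoothFamily (hJ : IsOpen J) (hX : IsSmoothFamilyOfEmbeddings J X)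
    {s₀ : ℝ} (hs : s₀ ∈ J) (p : M) : ContinuousAt (fun q : ℝ × M ↦ X q.1 q.2) (s₀, p) :=
  hX.contMDiffOn.continuousOn.continuousAt ((hJ.prod isOpen_univ).mem_nhds ⟨hs, mem_univ _⟩)

/-- Close to a point of the hypersurface, and in directions making a large angle with the tangent
space, the hypersurface is not met again; this is locally uniform in the family. -/
theorem eventually_add_ne (hJ : IsOpen J) (hX : IsSmoothFamilyOfEmbeddings J X) {s₀ : ℝ}
    (hs : s₀ ∈ J) {x : M} {u₀ : EuclideanSpace ℝ (Fin n)}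
    (hu₀ : u₀ ∈ (chartAt (EuclideanSpace ℝ (Fin n)) x).target) {N : Ambient n} (hN : ‖N‖ = 1)
    (hNX : ∀ i, inner ℝ N (coordDeriv (X s₀) x u₀ i) = 0) :
    ∀ᶠ r : (ℝ × EuclideanSpace ℝ (Fin n)) × Ambient n in 𝓝 ((s₀, u₀), 0),
      r.2 ≠ 0 → ‖r.2‖ / 2 ≤ inner ℝ r.2 N →
        ∀ p, chartRep X x r.1 + r.2 ≠ X r.1.1 p := by
  set c := chartAt (EuclideanSpace ℝ (Fin n)) x
  have hΩ : IsOpen (J ×ˢ c.target) := hJ.prod c.open_target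
  have hq : (s₀, u₀) ∈ J ×ˢ c.target := ⟨hs, hu₀⟩
  have hΦ := contDiffOn_chartRep hX.contMDiffOn x
  have hli : LinearIndependent ℝ (coordDeriv (X s₀) x u₀) :=
    linearIndependent_coordDeriv (hX.isSmoothEmbedding s₀ hs).isImmersion hu₀
  have hstrict : HasStrictFDerivAt (chartRep X x) (fderiv ℝ (chartRep X x) (s₀, u₀)) (s₀, u₀) :=
    ((hΦ _ hq).contDiffAt (hΩ.mem_nhds hq)).hasStrictFDerivAt (by simp)
  let A : EuclideanSpace ℝ (Fin n) →L[ℝ] Ambient n :=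
    (fderiv ℝ (chartRep X x) (s₀, u₀)).comp (ContinuousLinearMap.inr ℝ ℝ _)
  have hA : ∀ w, A w = ∑ i, w i • coordDeriv (X s₀) x u₀ i := by
    intro w
    conv_lhs => rw [← (EuclideanSpace.basisFun (Fin n) ℝ).sum_repr w]
    rw [map_sum]
    refine Finset.sum_congr rfl fun i _ ↦ ?_
    rw [map_smul, coordDeriv_eq_fderiv_chartRep (differentiableAt_of_contDiffOn hΦ hΩ hq)]
    simp [A]
  have hAN : ∀ w, inner ℝ (A w) N = 0 := by
    intro w
    rw [hA, sum_inner]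
    refine Finset.sum_eq_zero fun i _ ↦ ?_
    rw [inner_smul_left, real_inner_comm, hNX, mul_zero]
  have hinj : LinearMap.ker A.toLinearMap = ⊥ := by
    rw [LinearMap.ker_eq_bot']
    intro w hw
    have h1 := Fintype.linearIndependent_iff.1 hli (fun i ↦ w i) ((hA w).symm.trans hw)
    ext i
    exact h1 i
  obtain ⟨K, hK, hKA⟩ := A.toLinearMap.exists_antilipschitzWith hinj
  have hKA' : ∀ w, ‖w‖ ≤ K * ‖A w‖ := fun w ↦ by
    simpa using hKA.le_mul_dist w 0
  have hKpos : (0 : ℝ) < K := hK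
  -- With this tolerance the linearization error below is at most `‖r.2‖ / 3`, less than the `‖r.2‖
  -- / 2` allowed by the angle condition.
  have hε : (0 : ℝ) < 1 / (4 * K) := by positivity
  have hev := (hasStrictFDerivAt_iff_isLittleO.1 hstrict).def hε
  -- Strict differentiability compared at two points with the same parameter: one linear map `A`
  -- serves all nearby members of the family.
  have hev' : ∀ᶠ a : ℝ × (EuclideanSpace ℝ (Fin n) × EuclideanSpace ℝ (Fin n)) in
      𝓝 (s₀, (u₀, u₀)), ‖chartRep X x (a.1, a.2.1) - chartRep X x (a.1, a.2.2)
        - A (a.2.1 - a.2.2)‖ ≤ 1 / (4 * K) * ‖a.2.1 - a.2.2‖ := by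
    have hcont : ContinuousAt (fun a : ℝ × (EuclideanSpace ℝ (Fin n) × EuclideanSpace ℝ (Fin n)) ↦
        ((a.1, a.2.1), (a.1, a.2.2))) (s₀, (u₀, u₀)) := by fun_prop
    filter_upwards [hcont.eventually hev] with a ha
    have e1 : ((a.1, a.2.1) : ℝ × EuclideanSpace ℝ (Fin n)) - (a.1, a.2.2)
        = (0, a.2.1 - a.2.2) := by simp
    simp only [e1] at ha
    simpa [A, Prod.norm_mk] using ha
  rw [nhds_prod_eq, nhds_prod_eq, eventually_prod_iff] at hev'
  obtain ⟨P, hP, Q, hQ, hPQ⟩ := hev'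
  obtain ⟨Q₁, hQ₁, Q₂, hQ₂, hQQ⟩ := eventually_prod_iff.1 hQ
  obtain ⟨O, hOQ, hO, huO⟩ := eventually_nhds_iff.1 hQ₁
  let V : Set M := c.source ∩ c ⁻¹' O
  have hV : IsOpen V := c.isOpen_inter_preimage hO
  have hcs : ContinuousAt c.symm u₀ := c.continuousAt_symm hu₀
  -- Points outside `V` are excluded by injectivity of `X s₀` and compactness; only points in `V`
  -- need the linearization.
  have hfar : ∀ᶠ r : (ℝ × EuclideanSpace ℝ (Fin n)) × Ambient n in 𝓝 ((s₀, u₀), 0),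
      ∀ p ∈ Vᶜ, chartRep X x r.1 + r.2 ≠ X r.1.1 p := by
    refine hV.isClosed_compl.isCompact.eventually_forall_of_forall_eventually fun p hp ↦ ?_
    have h1 : chartRep X x (s₀, u₀) + 0 ≠ X s₀ p := by
      rw [add_zero]
      intro h
      have h2 := (hX.isSmoothEmbedding s₀ hs).isEmbedding.injective h
      exact hp (h2 ▸ ⟨c.map_target hu₀, by
        rw [mem_preimage, c.right_inv hu₀]; exact huO⟩)
    have h2 : ContinuousAt (fun b : ((ℝ × EuclideanSpace ℝ (Fin n)) × Ambient n) × M ↦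
        chartRep X x b.1.1 + b.1.2) (((s₀, u₀), 0), p) := by
      refine ContinuousAt.add (ContinuousAt.comp (g := chartRep X x) ?_ (by fun_prop))
        (by fun_prop)
      exact hstrict.continuousAt
    have h3 : ContinuousAt (fun b : ((ℝ × EuclideanSpace ℝ (Fin n)) × Ambient n) × M ↦
        X b.1.1.1 b.2) (((s₀, u₀), 0), p) :=
      ContinuousAt.comp (g := fun q : ℝ × M ↦ X q.1 q.2) (x := (((s₀, u₀), 0), p))
        (f := fun b : ((ℝ × EuclideanSpace ℝ (Fin n)) × Ambient n) × M ↦ (b.1.1.1, b.2)) (continuousAt_of_isSmoothFamily hJ hX hs p) (by fun_prop)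
    exact ((h2.sub h3).eventually_ne (sub_ne_zero.2 h1)).mono fun _ ↦ sub_ne_zero.1
  have hPr : ∀ᶠ r : (ℝ × EuclideanSpace ℝ (Fin n)) × Ambient n in 𝓝 ((s₀, u₀), 0),
      P r.1.1 ∧ Q₂ r.1.2 := by
    have h1 : ContinuousAt (fun r : (ℝ × EuclideanSpace ℝ (Fin n)) × Ambient n ↦ r.1.1)
      ((s₀, u₀), 0) := by fun_prop
    have h2 : ContinuousAt (fun r : (ℝ × EuclideanSpace ℝ (Fin n)) × Ambient n ↦ r.1.2)
      ((s₀, u₀), 0) := by fun_prop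
    exact (h1.eventually hP).and (h2.eventually hQ₂)
  filter_upwards [hfar, hPr] with r hr1 hr2 hr0 hrN p
  by_cases hp : p ∈ V
  swap
  · exact hr1 p hp
  intro heq
  have h1 := hPQ hr2.1 (hQQ (hOQ _ hp.2) hr2.2)
  simp only at h1
  have h2 : chartRep X x (r.1.1, c p) = X r.1.1 p := by
    simp only [chartRep]
    rw [c.left_inv hp.1]
  have h3 : chartRep X x (r.1.1, c p) - chartRep X x (r.1.1, r.1.2) = r.2 := by
    rw [h2, ← heq, add_sub_cancel_left]
  rw [h3] at h1
  set w := c p - r.1.2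
  -- `A w` is orthogonal to `N`, so only the linearization error contributes to `⟨r.2, N⟩`.
  have h4 : inner ℝ r.2 N ≤ 1 / (4 * K) * ‖w‖ := by
    have h5 : inner ℝ r.2 N = inner ℝ (r.2 - A w) N := by
      rw [inner_sub_left, hAN, sub_zero]
    rw [h5]
    refine (real_inner_le_norm _ _).trans ?_
    rw [hN, mul_one]
    exact h1
  have h5 : ‖w‖ ≤ K * (‖r.2‖ + 1 / (4 * K) * ‖w‖) := by
    refine (hKA' w).trans (mul_le_mul_of_nonneg_left ?_ hKpos.le)
    have := norm_sub_le r.2 (r.2 - A w)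
    rw [sub_sub_cancel] at this
    linarith
  have h6 : K * (‖r.2‖ + 1 / (4 * K) * ‖w‖) = K * ‖r.2‖ + ‖w‖ / 4 := by
    field_simp
  have h7 : 0 < ‖r.2‖ := norm_pos_iff.2 hr0
  have h8 : 1 / (4 * K) * ‖w‖ ≤ ‖r.2‖ / 3 := by
    rw [h6] at h5
    rw [one_div, inv_mul_le_iff₀ (by positivity)]
    linarith
  linarith

omit [IsManifold (𝓡 n) ∞ M] [CompactSpace M] in
theorem chartAt_symm_mem_connectedComponent {x : M} {u₀ : EuclideanSpace ℝ (Fin n)}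
    (hu₀ : u₀ ∈ (chartAt (EuclideanSpace ℝ (Fin n)) x).target) :
    ∀ᶠ u in 𝓝 u₀, connectedComponent ((chartAt (EuclideanSpace ℝ (Fin n)) x).symm u)
      = connectedComponent ((chartAt (EuclideanSpace ℝ (Fin n)) x).symm u₀) := by
  have : LocallyConnectedSpace M := ChartedSpace.locallyConnectedSpace (EuclideanSpace ℝ (Fin n)) M
  filter_upwards [((chartAt (EuclideanSpace ℝ (Fin n)) x).continuousAt_symm hu₀).preimage_mem_nhds
    (isOpen_connectedComponent.mem_nhds mem_connectedComponent)] with u hu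
  exact (connectedComponent_eq hu).symm

/-- A continuous field of unit normals which is outward at one point is outward nearby: it cannot
be opposite to the outward normal. -/
theorem eventually_ne_neg_normal (hJ : IsOpen J) (hX : IsSmoothFamilyOfEmbeddings J X)
    (hν : ∀ s ∈ J, IsOutwardUnitNormal (X s) (ν s)) {s₀ : ℝ} (hs : s₀ ∈ J) {x : M}
    {u₀ : EuclideanSpace ℝ (Fin n)}
    (hu₀ : u₀ ∈ (chartAt (EuclideanSpace ℝ (Fin n)) x).target)
    {e : ℝ × EuclideanSpace ℝ (Fin n) → Ambient n} (he : ContinuousAt e (s₀, u₀))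
    (he1 : ∀ᶠ q in 𝓝 (s₀, u₀), ‖e q‖ = 1) (he0 : e (s₀, u₀) = chartRep ν x (s₀, u₀)) :
    ∀ᶠ q in 𝓝 (s₀, u₀), chartRep ν x q ≠ -e q := by
  set c := chartAt (EuclideanSpace ℝ (Fin n)) x
  set p₀ := c.symm u₀
  set N := ν s₀ p₀ with hNdef
  have hΩ : IsOpen (J ×ˢ c.target) := hJ.prod c.open_target
  have hq₀ : (s₀, u₀) ∈ J ×ˢ c.target := ⟨hs, hu₀⟩
  have hN : ‖N‖ = 1 := (hν s₀ hs).norm_eq_one p₀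
  have hN0 : e (s₀, u₀) = N := he0
  have hΦ : ContinuousAt (chartRep X x) (s₀, u₀) :=
    (contDiffOn_chartRep hX.contMDiffOn x).continuousOn.continuousAt (hΩ.mem_nhds hq₀)
  have hL1 := eventually_add_ne hJ hX hs hu₀ hN fun i ↦
    inner_normal_coordDeriv (hX.isSmoothEmbedding s₀ hs).contMDiff (hν s₀ hs) hu₀ i
  rw [nhds_prod_eq, eventually_prod_iff] at hL1
  obtain ⟨P, hP, Q, hQ, hPQ⟩ := hL1
  obtain ⟨r, hr, hrQ⟩ := Metric.eventually_nhds_iff_ball.1 hQ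
  -- A fixed length `t₀`, chosen at the base point alone; the length `τ < t₀` below may depend on
  -- `q`.
  obtain ⟨t₀, ⟨hout, hunb⟩, ht₀, htr⟩ : ∃ t : ℝ, (X s₀ p₀ + t • ν s₀ p₀ ∉
      X s₀ '' connectedComponent p₀ ∧ ¬ IsBounded (connectedComponentIn
        (X s₀ '' connectedComponent p₀)ᶜ (X s₀ p₀ + t • ν s₀ p₀))) ∧ 0 < t ∧ t < r := by
    have h1 : ∀ᶠ t : ℝ in 𝓝[>] 0, 0 < t ∧ t < r := by
      filter_upwards [Ioo_mem_nhdsGT hr] with t ht using ht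
    exact (((hν s₀ hs).outside p₀).and h1).exists
  have hC : IsCompact (connectedComponent p₀) := isClosed_connectedComponent.isCompact
  have hL2 := eventually_not_isBounded_connectedComponentIn hC
    (continuousAt_of_isSmoothFamily hJ hX hs) hout hunb
  have hlim : Tendsto (fun q : ℝ × EuclideanSpace ℝ (Fin n) ↦
      (q.1, chartRep X x q + t₀ • e q)) (𝓝 (s₀, u₀)) (𝓝 (s₀, X s₀ p₀ + t₀ • ν s₀ p₀)) := by
    have h1 : ContinuousAt (fun q : ℝ × EuclideanSpace ℝ (Fin n) ↦
      (q.1, chartRep X x q + t₀ • e q)) (s₀, u₀) :=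
      continuousAt_fst.prodMk (hΦ.add (he.const_smul t₀))
    have h2 := h1.tendsto
    simp only [hN0] at h2
    exact h2
  have hcomp : ∀ᶠ q : ℝ × EuclideanSpace ℝ (Fin n) in 𝓝 (s₀, u₀),
      connectedComponent (c.symm q.2) = connectedComponent p₀ :=
    (continuousAt_snd (p := (s₀, u₀))).eventually (chartAt_symm_mem_connectedComponent hu₀)
  have hang : ∀ᶠ q in 𝓝 (s₀, u₀), 1 / 2 < inner ℝ (e q) N := by
    refine continuousAt_const.eventually_lt (ContinuousAt.inner (𝕜 := ℝ) he continuousAt_const) ?_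
    rw [hN0, real_inner_self_eq_norm_sq, hN]
    norm_num
  filter_upwards [hP, hlim.eventually hL2, hcomp, hang, he1, hΩ.mem_nhds hq₀]
    with q h1 h2 h3 h4 h5 h6 hneg
  obtain ⟨s, u⟩ := q
  simp only at h2 h3
  have hneg' : ν s (c.symm u) = -e (s, u) := hneg
  obtain ⟨τ, ⟨hin, hbdd⟩, hτ, hτt⟩ : ∃ t : ℝ, (X s (c.symm u) - t • ν s (c.symm u) ∉
      X s '' connectedComponent (c.symm u) ∧ IsBounded (connectedComponentIn
        (X s '' connectedComponent (c.symm u))ᶜ (X s (c.symm u) - t • ν s (c.symm u)))) ∧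
      0 < t ∧ t < t₀ := by
    have h1 : ∀ᶠ t : ℝ in 𝓝[>] 0, 0 < t ∧ t < t₀ := by
      filter_upwards [Ioo_mem_nhdsGT ht₀] with t ht using ht
    exact (((hν s h6.1).inside (c.symm u)).and h1).exists
  rw [hneg', smul_neg, sub_neg_eq_add, h3] at hbdd
  -- If `ν = -e`, this segment would join the inner side at `τ` to the unbounded side at `t₀`
  -- without meeting the hypersurface.
  let T : Set (Ambient n) := (fun t : ℝ ↦ X s (c.symm u) + t • e (s, u)) '' Icc τ t₀
  have hT : IsPreconnected T := isPreconnected_Icc.image _ (by fun_prop)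
  have hTs : T ⊆ (X s '' connectedComponent p₀)ᶜ := by
    rintro a ⟨t, ht, rfl⟩ ⟨p, -, hp⟩
    have htpos : 0 < t := hτ.trans_le ht.1
    have hnorm : ‖t • e (s, u)‖ = t := by
      rw [norm_smul, h5, mul_one, Real.norm_of_nonneg htpos.le]
    refine hPQ h1 (hrQ (t • e (s, u)) ?_) ?_ ?_ p hp.symm
    · rw [mem_ball_zero_iff, hnorm]
      exact ht.2.trans_lt htr
    · rw [← norm_pos_iff, hnorm]
      exact htpos
    · rw [hnorm, inner_smul_left]
      simp only [conj_trivial]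
      nlinarith
  have hmem : ∀ t ∈ Icc τ t₀, X s (c.symm u) + t • e (s, u) ∈ T := fun t ht ↦ ⟨t, ht, rfl⟩
  have hsub := hT.subset_connectedComponentIn (hmem τ ⟨le_rfl, hτt.le⟩) hTs
  have heq := connectedComponentIn_eq (hsub (hmem t₀ ⟨hτt.le, le_rfl⟩))
  rw [heq] at hbdd
  exact h2 hbdd

/-- The outward unit normal of a smooth family of embeddings is smooth. -/
theorem contDiffOn_chartRep_normal (hJ : IsOpen J) (hX : IsSmoothFamilyOfEmbeddings J X)
    (hν : ∀ s ∈ J, IsOutwardUnitNormal (X s) (ν s)) (x : M) :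
    ContDiffOn ℝ ∞ (chartRep ν x)
      (J ×ˢ (chartAt (EuclideanSpace ℝ (Fin n)) x).target) := by
  set c := chartAt (EuclideanSpace ℝ (Fin n)) x
  have hΩ : IsOpen (J ×ˢ c.target) := hJ.prod c.open_target
  have hli : ∀ q ∈ J ×ˢ c.target, LinearIndependent ℝ (coordDeriv (X q.1) x q.2) := fun q hq ↦
    linearIndependent_coordDeriv (hX.isSmoothEmbedding q.1 hq.1).isImmersion hq.2
  have horth : ∀ q ∈ J ×ˢ c.target, ∀ i, inner ℝ (chartRep ν x q) (coordDeriv (X q.1) x q.2 i) = 0 :=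
    fun q hq i ↦ inner_normal_coordDeriv (hX.isSmoothEmbedding q.1 hq.1).contMDiff
      (hν q.1 hq.1) hq.2 i
  have hXd := contDiffOn_coordDeriv_family hΩ (contDiffOn_chartRep hX.contMDiffOn x)
  rintro ⟨s₀, u₀⟩ hq₀
  set N := chartRep ν x (s₀, u₀)
  have hN : ‖N‖ = 1 := (hν s₀ hq₀.1).norm_eq_one _
  -- The fixed vector `N` projected to the moving normal line: smooth in `q`, and equal to `N` at
  -- the base point.
  let m : ℝ × EuclideanSpace ℝ (Fin n) → Ambient n := fun q ↦
    N - tangentialPart (coordDeriv (X q.1) x q.2) N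
  have hm : ContDiffOn ℝ ∞ m (J ×ˢ c.target) := by
    refine contDiffOn_const.sub (ContDiffOn.sum fun l _ ↦ ContDiffOn.fun_smul
      (ContDiffOn.sum fun k _ ↦ ContDiffOn.mul ?_ ?_) (hXd l))
    · exact contDiffOn_metricMatrix_inv (X := fun q : ℝ × EuclideanSpace ℝ (Fin n) ↦ X q.1)
        (u := fun q ↦ q.2) hXd hli l k
    · exact contDiffOn_const.inner ℝ (hXd k)
  have hm0 : m (s₀, u₀) = N := by
    simp only [m, tangentialPart, N, horth _ hq₀, mul_zero, Finset.sum_const_zero, zero_smul,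
      sub_zero]
  have hmc := (hm _ hq₀).contDiffAt (hΩ.mem_nhds hq₀)
  have hmne : m (s₀, u₀) ≠ 0 := by
    rw [hm0, ← norm_ne_zero_iff, hN]
    exact one_ne_zero
  let e : ℝ × EuclideanSpace ℝ (Fin n) → Ambient n := fun q ↦ ‖m q‖⁻¹ • m q
  have he : ContDiffAt ℝ ∞ e (s₀, u₀) :=
    ((hmc.norm ℝ hmne).inv (norm_ne_zero_iff.2 hmne)).smul hmc
  have hmev : ∀ᶠ q in 𝓝 (s₀, u₀), m q ≠ 0 := hmc.continuousAt.eventually_ne hmne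
  have he1 : ∀ᶠ q in 𝓝 (s₀, u₀), ‖e q‖ = 1 := by
    filter_upwards [hmev] with q hq
    rw [norm_smul, norm_inv, norm_norm, inv_mul_cancel₀ (norm_ne_zero_iff.2 hq)]
  have he0 : e (s₀, u₀) = N := by
    simp only [e, hm0, hN, inv_one, one_smul]
  have hne := eventually_ne_neg_normal hJ hX hν hq₀.1 hq₀.2 he.continuousAt he1 he0
  refine (he.congr_of_eventuallyEq ?_).contDiffWithinAt
  filter_upwards [hne, he1, hΩ.mem_nhds hq₀] with q h1 h2 h3
  have h4 : ∀ i, inner ℝ (e q) (coordDeriv (X q.1) x q.2 i) = 0 := by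
    intro i
    rw [inner_smul_left, inner_sub_left, inner_tangentialPart (hli q h3), sub_self, mul_zero]
  have h5 : e q ≠ 0 := by
    rw [← norm_ne_zero_iff, h2]
    exact one_ne_zero
  obtain ⟨a, ha⟩ := exists_eq_smul_of_orthogonal (hli q h3) h5 h4 (horth q h3)
  have h6 : |a| = 1 := by
    have : ‖chartRep ν x q‖ = 1 := (hν q.1 h3.1).norm_eq_one _
    rwa [ha, norm_smul, h2, mul_one, Real.norm_eq_abs] at this
  rcases eq_or_eq_neg_of_abs_eq h6 with h7 | h7
  · rw [ha, h7, one_smul]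
  · rw [h7, neg_smul, one_smul] at ha
    exact absurd ha h1

end Normal

/-! ### Differentiation under the integral sign. -/

section CompactSupport

variable {E : Type*} [NormedAddCommGroup E] [NormedSpace ℝ E] [MeasurableSpace E] [BorelSpace E]
  {μ : Measure E} [IsFiniteMeasureOnCompacts μ] {T K : Set E}

omit [NormedSpace ℝ E] in
theorem integrableOn_of_continuousOn_of_isCompact {g : E → ℝ} (hT : IsOpen T) (hK : IsCompact K)
    (hKT : K ⊆ T) (hg : ContinuousOn g T) (h0 : ∀ u ∈ T, u ∉ K → g u = 0) :
    IntegrableOn g T μ :=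
  ((hg.mono hKT).integrableOn_compact hK).of_forall_sdiff_eq_zero hT.measurableSet
    fun u hu ↦ h0 u hu.1 hu.2

/-- Differentiation under the integral sign for smooth integrands with compact support. -/
theorem hasDerivAt_setIntegral_mul {J : Set ℝ} (hJ : IsOpen J) (hT : IsOpen T) (hK : IsCompact K)
    (hKT : K ⊆ T) {ρ : E → ℝ} (hρ : ContinuousOn ρ T) (h0 : ∀ u ∈ T, u ∉ K → ρ u = 0)
    {Φ : ℝ × E → ℝ} (hΦ : ContDiffOn ℝ ∞ Φ (J ×ˢ T)) {s : ℝ} (hs : s ∈ J) :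
    HasDerivAt (fun t ↦ ∫ u in T, ρ u * Φ (t, u) ∂μ)
      (∫ u in T, ρ u * fderiv ℝ Φ (s, u) (1, 0) ∂μ) s := by
  have hΩ : IsOpen (J ×ˢ T) := hJ.prod hT
  have hd : ContinuousOn (fun q ↦ fderiv ℝ Φ q (1, 0)) (J ×ˢ T) :=
    (contDiffOn_fderiv_apply hΦ hΩ _).continuousOn
  obtain ⟨ε, hε, hεJ⟩ := Metric.nhds_basis_closedBall.mem_iff.1 (hJ.mem_nhds hs)
  have hcomp : IsCompact (Metric.closedBall s ε ×ˢ K) := (isCompact_closedBall s ε).prod hK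
  have hcont : ContinuousOn (fun q : ℝ × E ↦ ρ q.2 * fderiv ℝ Φ q (1, 0)) (J ×ˢ T) :=
    (hρ.comp continuousOn_snd fun q hq ↦ hq.2).mul hd
  -- The dominating function is this constant on `K` and zero elsewhere.
  obtain ⟨C, hC⟩ := hcomp.exists_bound_of_continuousOn (hcont.mono (prod_mono hεJ hKT))
  have hslice : ∀ {g : ℝ × E → ℝ}, ContinuousOn g (J ×ˢ T) → ∀ t ∈ J,
      ContinuousOn (fun u ↦ ρ u * g (t, u)) T := fun hg t ht ↦
    hρ.mul (hg.comp (Continuous.prodMk_right t).continuousOn fun u hu ↦ ⟨ht, hu⟩)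
  have hint : ∀ {g : ℝ × E → ℝ}, ContinuousOn g (J ×ˢ T) → ∀ t ∈ J,
      IntegrableOn (fun u ↦ ρ u * g (t, u)) T μ := fun hg t ht ↦
    integrableOn_of_continuousOn_of_isCompact hT hK hKT (hslice hg t ht)
      fun u hu huK ↦ by rw [h0 u hu huK, zero_mul]
  refine (hasDerivAt_integral_of_dominated_loc_of_deriv_le (μ := μ.restrict T)
    (F := fun t u ↦ ρ u * Φ (t, u)) (F' := fun t u ↦ ρ u * fderiv ℝ Φ (t, u) (1, 0))
    (bound := K.indicator fun _ ↦ C) (Metric.closedBall_mem_nhds s hε) ?_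
    (hint hΦ.continuousOn s hs) (hint hd s hs).aestronglyMeasurable ?_ ?_ ?_).2
  · filter_upwards [hJ.mem_nhds hs] with t ht
    exact (hint hΦ.continuousOn t ht).aestronglyMeasurable
  · refine (ae_restrict_iff' hT.measurableSet).2 (ae_of_all _ fun u hu t ht ↦ ?_)
    by_cases huK : u ∈ K
    · rw [indicator_of_mem huK]
      exact hC (t, u) ⟨ht, huK⟩
    · rw [indicator_of_notMem huK, h0 u hu huK, zero_mul, norm_zero]
  · refine Integrable.integrableOn ?_
    exact (integrable_indicator_iff hK.measurableSet).2 (integrableOn_const hK.measure_lt_top.ne)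
  · refine (ae_restrict_iff' hT.measurableSet).2 (ae_of_all _ fun u hu t ht ↦ ?_)
    exact (hasDerivAt_slice_left
      (differentiableAt_of_contDiffOn hΦ hΩ ⟨hεJ ht, hu⟩)).const_mul (ρ u)

end CompactSupport

/-! ### Integration against the volume measure. -/

section Volume

variable (n : ℕ) (M : Type*) [TopologicalSpace M] [ChartedSpace (EuclideanSpace ℝ (Fin n)) M]
  [IsManifold (𝓡 n) ∞ M] [T2Space M] [CompactSpace M]

/-- The indices of the nonzero functions of the partition of unity. -/
def chartIndex : Finset M :=
  (LocallyFinite.finite_nonempty_of_compact (chartPartition n M).locallyFinite).toFinset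

variable {n M}

theorem chartPartition_eq_zero {x : M} (hx : x ∉ chartIndex n M) (p : M) :
    chartPartition n M x p = 0 := by
  by_contra h
  exact hx ((Finite.mem_toFinset _).2 ⟨p, h⟩)

theorem sum_chartPartition (p : M) : ∑ x ∈ chartIndex n M, chartPartition n M x p = 1 := by
  refine (chartPartition n M).sum_finsupport' p (mem_univ p) fun x hx ↦ ?_
  rw [SmoothPartitionOfUnity.mem_finsupport] at hx
  exact (Finite.mem_toFinset _).2 ⟨p, hx⟩

omit [IsManifold (𝓡 n) ∞ M] [T2Space M] in
theorem isCompact_image_chartAt {x : M} {A : Set M} (hA : IsClosed A)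
    (hAs : A ⊆ (chartAt (EuclideanSpace ℝ (Fin n)) x).source) :
    IsCompact (chartAt (EuclideanSpace ℝ (Fin n)) x '' A) :=
  hA.isCompact.image_of_continuousOn
    ((chartAt (EuclideanSpace ℝ (Fin n)) x).continuousOn.mono hAs)

omit [IsManifold (𝓡 n) ∞ M] [T2Space M] [CompactSpace M] in
theorem image_chartAt_subset_target {x : M} {A : Set M}
    (hAs : A ⊆ (chartAt (EuclideanSpace ℝ (Fin n)) x).source) :
    chartAt (EuclideanSpace ℝ (Fin n)) x '' A ⊆ (chartAt (EuclideanSpace ℝ (Fin n)) x).target :=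
  (image_mono hAs).trans (chartAt (EuclideanSpace ℝ (Fin n)) x).image_source_eq_target.subset

omit [IsManifold (𝓡 n) ∞ M] [T2Space M] [CompactSpace M] in
theorem chartAt_symm_notMem {x : M} {A : Set M} {u : EuclideanSpace ℝ (Fin n)}
    (hu : u ∈ (chartAt (EuclideanSpace ℝ (Fin n)) x).target)
    (huA : u ∉ chartAt (EuclideanSpace ℝ (Fin n)) x '' A) :
    (chartAt (EuclideanSpace ℝ (Fin n)) x).symm u ∉ A := fun h ↦
  huA ⟨_, h, (chartAt (EuclideanSpace ℝ (Fin n)) x).right_inv hu⟩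

theorem chartPartition_symm_eq_zero {x : M} {u : EuclideanSpace ℝ (Fin n)}
    (hu : u ∈ (chartAt (EuclideanSpace ℝ (Fin n)) x).target)
    (huK : u ∉ chartAt (EuclideanSpace ℝ (Fin n)) x '' tsupport (chartPartition n M x)) :
    chartPartition n M x ((chartAt (EuclideanSpace ℝ (Fin n)) x).symm u) = 0 :=
  image_eq_zero_of_notMem_tsupport (chartAt_symm_notMem hu huK)

omit [T2Space M] [CompactSpace M] in
theorem continuousOn_sqrt_det {X : M → Ambient n}
    (hX : Manifold.IsSmoothEmbedding (𝓡 n) 𝓘(ℝ, Ambient n) ∞ X) (x : M) :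
    ContinuousOn (fun u ↦ √(metricMatrix X x u).det)
      (chartAt (EuclideanSpace ℝ (Fin n)) x).target :=
  (contDiffOn_sqrt_det_metricMatrix (X := fun _ ↦ X) (u := id)
    (contDiffOn_coordDeriv (chartAt (EuclideanSpace ℝ (Fin n)) x).open_target
      (contDiffOn_comp_chartAt_symm hX.contMDiff x))
    fun _ hu ↦ linearIndependent_coordDeriv hX.isImmersion hu).continuousOn

variable [MeasurableSpace M] [BorelSpace M] {X : M → Ambient n} {f : M → ℝ}

/-- The contribution of one chart to the volume measure. -/
def chartVolume (X : M → Ambient n) (x : M) : Measure M :=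
  ((volume.restrict (chartAt (EuclideanSpace ℝ (Fin n)) x).target).withDensity
      (fun u ↦ ENNReal.ofReal
        (chartPartition n M x ((chartAt (EuclideanSpace ℝ (Fin n)) x).symm u)
          * Real.sqrt (metricMatrix X x u).det))).map
      (chartAt (EuclideanSpace ℝ (Fin n)) x).symm

omit [BorelSpace M] in
theorem volumeMeasure_eq_sum (X : M → Ambient n) :
    volumeMeasure X = ∑ x ∈ chartIndex n M, chartVolume X x := by
  ext A hA
  change (Measure.sum fun x ↦ chartVolume X x) A = _
  rw [Measure.sum_apply _ hA, Measure.finsetSum_apply]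
  refine tsum_eq_sum fun x hx ↦ ?_
  have : chartVolume X x = 0 := by
    simp only [chartVolume, chartPartition_eq_zero hx, zero_mul, ENNReal.ofReal_zero]
    rw [show (fun _ : EuclideanSpace ℝ (Fin n) ↦ (0 : ENNReal)) = 0 from rfl, withDensity_zero,
      Measure.map_zero]
  rw [this, Measure.coe_zero, Pi.zero_apply]

omit [MeasurableSpace M] [BorelSpace M] in
theorem continuousOn_chart_density
    (hX : Manifold.IsSmoothEmbedding (𝓡 n) 𝓘(ℝ, Ambient n) ∞ X) (x y : M) :
    ContinuousOn (fun u ↦ chartPartition n M y ((chartAt (EuclideanSpace ℝ (Fin n)) x).symm u)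
      * √(metricMatrix X x u).det) (chartAt (EuclideanSpace ℝ (Fin n)) x).target :=
  ((chartPartition n M y).contMDiff.continuous.comp_continuousOn
    (chartAt (EuclideanSpace ℝ (Fin n)) x).continuousOn_symm).mul (continuousOn_sqrt_det hX x)

/-- The partition function has compact support inside the chart, so continuity of `f` already gives
integrability. -/
theorem integrable_and_integral_chartVolume
    (hX : Manifold.IsSmoothEmbedding (𝓡 n) 𝓘(ℝ, Ambient n) ∞ X) (hf : Continuous f) (x : M) :
    Integrable f (chartVolume X x) ∧ ∫ p, f p ∂(chartVolume X x)
      = ∫ u in (chartAt (EuclideanSpace ℝ (Fin n)) x).target,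
        chartPartition n M x ((chartAt (EuclideanSpace ℝ (Fin n)) x).symm u)
          * √(metricMatrix X x u).det * f ((chartAt (EuclideanSpace ℝ (Fin n)) x).symm u) := by
  set c := chartAt (EuclideanSpace ℝ (Fin n)) x
  have hc := continuousOn_chart_density hX x x
  have hsub := chartPartition_isSubordinate n M x
  have hmeas : AEMeasurable (fun u ↦ ENNReal.ofReal (chartPartition n M x (c.symm u)
      * √(metricMatrix X x u).det)) (volume.restrict c.target) :=
    (hc.aemeasurable c.open_target.measurableSet).ennreal_ofReal
  have hsymm : AEMeasurable c.symm ((volume.restrict c.target).withDensity (fun u ↦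
      ENNReal.ofReal (chartPartition n M x (c.symm u) * √(metricMatrix X x u).det))) :=
    (c.continuousOn_symm.aemeasurable c.open_target.measurableSet).mono_ac
      (withDensity_absolutelyContinuous _ _)
  have hreal : ∀ u, (ENNReal.ofReal (chartPartition n M x (c.symm u)
      * √(metricMatrix X x u).det)).toReal
      = chartPartition n M x (c.symm u) * √(metricMatrix X x u).det := fun u ↦
    ENNReal.toReal_ofReal (mul_nonneg ((chartPartition n M).nonneg _ _) (Real.sqrt_nonneg _))
  constructor
  · refine (integrable_map_measure hf.aestronglyMeasurable hsymm).2 ?_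
    rw [integrable_withDensity_iff_integrable_smul₀' hmeas (ae_of_all _ fun _ ↦
      ENNReal.ofReal_lt_top)]
    simp only [hreal, smul_eq_mul, Function.comp_apply]
    exact integrableOn_of_continuousOn_of_isCompact c.open_target
      (isCompact_image_chartAt (isClosed_tsupport _) hsub) (image_chartAt_subset_target hsub)
      (hc.mul (hf.comp_continuousOn c.continuousOn_symm))
      fun u hu huK ↦ by rw [chartPartition_symm_eq_zero hu huK, zero_mul, zero_mul]
  · rw [chartVolume, integral_map hsymm hf.aestronglyMeasurable,
      integral_withDensity_eq_integral_toReal_smul₀ hmeas (ae_of_all _ fun _ ↦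
        ENNReal.ofReal_lt_top)]
    simp only [hreal, smul_eq_mul]

theorem integrable_volumeMeasure
    (hX : Manifold.IsSmoothEmbedding (𝓡 n) 𝓘(ℝ, Ambient n) ∞ X) (hf : Continuous f) :
    Integrable f (volumeMeasure X) := by
  rw [volumeMeasure_eq_sum, integrable_finsetSum_measure]
  exact fun x _ ↦ (integrable_and_integral_chartVolume hX hf x).1

theorem integral_volumeMeasure
    (hX : Manifold.IsSmoothEmbedding (𝓡 n) 𝓘(ℝ, Ambient n) ∞ X) (hf : Continuous f) :
    ∫ p, f p ∂(volumeMeasure X) = ∑ x ∈ chartIndex n M,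
      ∫ u in (chartAt (EuclideanSpace ℝ (Fin n)) x).target,
        chartPartition n M x ((chartAt (EuclideanSpace ℝ (Fin n)) x).symm u)
          * √(metricMatrix X x u).det * f ((chartAt (EuclideanSpace ℝ (Fin n)) x).symm u) := by
  rw [volumeMeasure_eq_sum, integral_finsetSum_measure
    fun x _ ↦ (integrable_and_integral_chartVolume hX hf x).1]
  exact Finset.sum_congr rfl fun x _ ↦ (integrable_and_integral_chartVolume hX hf x).2

omit [T2Space M] [CompactSpace M] [MeasurableSpace M] [BorelSpace M] in
/-- Change of variables between two charts. -/
theorem setIntegral_overlap (hX : Manifold.IsSmoothEmbedding (𝓡 n) 𝓘(ℝ, Ambient n) ∞ X)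
    (f : M → ℝ) (x y : M) :
    ∫ u in (chartAt (EuclideanSpace ℝ (Fin n)) x).target ∩
        (chartAt (EuclideanSpace ℝ (Fin n)) x).symm ⁻¹'
          (chartAt (EuclideanSpace ℝ (Fin n)) y).source,
        √(metricMatrix X x u).det * f ((chartAt (EuclideanSpace ℝ (Fin n)) x).symm u)
      = ∫ u in (chartAt (EuclideanSpace ℝ (Fin n)) y).target ∩
        (chartAt (EuclideanSpace ℝ (Fin n)) y).symm ⁻¹'
          (chartAt (EuclideanSpace ℝ (Fin n)) x).source,
        √(metricMatrix X y u).det * f ((chartAt (EuclideanSpace ℝ (Fin n)) y).symm u) := by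
  set cx := chartAt (EuclideanSpace ℝ (Fin n)) x
  set cy := chartAt (EuclideanSpace ℝ (Fin n)) y
  have hO := isOpen_overlap (n := n) x y
  have himg : (cy ∘ cx.symm) '' (cx.target ∩ cx.symm ⁻¹' cy.source)
      = cy.target ∩ cy.symm ⁻¹' cx.source := by
    ext v
    constructor
    · rintro ⟨u, ⟨hu, huy⟩, rfl⟩
      refine ⟨cy.map_source huy, ?_⟩
      simp only [mem_preimage, Function.comp_apply]
      rw [cy.left_inv huy]
      exact cx.map_target hu
    · rintro ⟨hv, hvx⟩
      refine ⟨cx (cy.symm v), ⟨cx.map_source hvx, ?_⟩, ?_⟩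
      · rw [mem_preimage, cx.left_inv hvx]
        exact cy.map_target hv
      · rw [Function.comp_apply, cx.left_inv hvx, cy.right_inv hv]
  have hinj : InjOn (cy ∘ cx.symm) (cx.target ∩ cx.symm ⁻¹' cy.source) :=
    cy.injOn.comp (cx.symm.injOn.mono inter_subset_left) fun u hu ↦ hu.2
  have hder : ∀ u ∈ cx.target ∩ cx.symm ⁻¹' cy.source, HasFDerivWithinAt (cy ∘ cx.symm)
      (jacobian x y u) (cx.target ∩ cx.symm ⁻¹' cy.source) u := fun u hu ↦
    (differentiableAt_of_contDiffOn (contDiffOn_chart_change x y) hO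
      hu).hasFDerivAt.hasFDerivWithinAt
  rw [← himg, integral_image_eq_integral_abs_det_fderiv_smul volume hO.measurableSet hder hinj]
  refine setIntegral_congr_fun hO.measurableSet fun u hu ↦ ?_
  have h1 := sqrt_det_metricMatrix_change hu.1 hu.2 (X := X)
    (differentiableAt_of_contDiffOn (contDiffOn_comp_chartAt_symm hX.contMDiff y)
      cy.open_target (cy.map_source hu.2))
  simp only [Function.comp_apply, smul_eq_mul]
  rw [h1, cy.left_inv hu.2, mul_assoc]

/-- The integral of a function supported in the domain of a chart. -/
theorem integral_volumeMeasure_of_support_subset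
    (hX : Manifold.IsSmoothEmbedding (𝓡 n) 𝓘(ℝ, Ambient n) ∞ X) (hf : Continuous f) {z : M}
    {A : Set M} (hA : IsClosed A) (hAz : A ⊆ (chartAt (EuclideanSpace ℝ (Fin n)) z).source)
    (hfA : ∀ p ∉ A, f p = 0) :
    ∫ p, f p ∂(volumeMeasure X) = ∫ u in (chartAt (EuclideanSpace ℝ (Fin n)) z).target,
      √(metricMatrix X z u).det * f ((chartAt (EuclideanSpace ℝ (Fin n)) z).symm u) := by
  set cz := chartAt (EuclideanSpace ℝ (Fin n)) z
  -- Each piece lives on the overlap with the chart at `z`: outside it either `f` or the partition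
  -- function vanishes. Moved to one chart, the pieces add up because the partition sums to one.
  have hterm : ∀ x : M, ∫ u in (chartAt (EuclideanSpace ℝ (Fin n)) x).target,
        chartPartition n M x ((chartAt (EuclideanSpace ℝ (Fin n)) x).symm u)
          * √(metricMatrix X x u).det * f ((chartAt (EuclideanSpace ℝ (Fin n)) x).symm u)
      = ∫ u in cz.target, chartPartition n M x (cz.symm u)
          * √(metricMatrix X z u).det * f (cz.symm u) := by
    intro x
    have h1 := setIntegral_overlap hX (fun p ↦ chartPartition n M x p * f p) x z
    have h2 : ∀ (y : M) (u : EuclideanSpace ℝ (Fin n)) (p : M),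
        chartPartition n M x p * √(metricMatrix X y u).det * f p
        = √(metricMatrix X y u).det * (chartPartition n M x p * f p) := fun _ _ _ ↦ by ring
    simp only [h2]
    rw [setIntegral_eq_of_subset_of_forall_sdiff_eq_zero
      (chartAt (EuclideanSpace ℝ (Fin n)) x).open_target.measurableSet
      (s := (chartAt (EuclideanSpace ℝ (Fin n)) x).target ∩
        (chartAt (EuclideanSpace ℝ (Fin n)) x).symm ⁻¹' cz.source) inter_subset_left, h1,
      ← setIntegral_eq_of_subset_of_forall_sdiff_eq_zero cz.open_target.measurableSet
      inter_subset_left]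
    · intro u hu
      have h3 : cz.symm u ∉ tsupport (chartPartition n M x) := fun h ↦
        hu.2 ⟨hu.1, chartPartition_isSubordinate n M x h⟩
      rw [image_eq_zero_of_notMem_tsupport h3]
      simp
    · intro u hu
      rw [hfA _ fun h ↦ hu.2 ⟨hu.1, hAz h⟩]
      simp
  rw [integral_volumeMeasure hX hf, Finset.sum_congr rfl fun x _ ↦ hterm x,
    ← integral_finsetSum]
  · refine setIntegral_congr_fun cz.open_target.measurableSet fun u _ ↦ ?_
    rw [← Finset.sum_mul, ← Finset.sum_mul, sum_chartPartition, one_mul]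
  · intro x _
    exact integrableOn_of_continuousOn_of_isCompact cz.open_target
      (isCompact_image_chartAt hA hAz) (image_chartAt_subset_target hAz)
      ((continuousOn_chart_density hX z x).mul (hf.comp_continuousOn cz.continuousOn_symm))
      fun u hu huA ↦ by rw [hfA _ (chartAt_symm_notMem hu huA), mul_zero]

end Volume

/-! ### The global divergence theorem and the first variation. -/

section Global

variable {n : ℕ} {M : Type*} [TopologicalSpace M] [ChartedSpace (EuclideanSpace ℝ (Fin n)) M]

/-- The map `W` is smooth in every chart. -/
def IsChartSmooth (W : M → Ambient n) : Prop :=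
  ∀ x, ContDiffOn ℝ ∞ (W ∘ (chartAt (EuclideanSpace ℝ (Fin n)) x).symm)
    (chartAt (EuclideanSpace ℝ (Fin n)) x).target

theorem IsChartSmooth.differentiableAt {W : M → Ambient n} (hW : IsChartSmooth W) {x : M} {u : EuclideanSpace ℝ (Fin n)}
    (hu : u ∈ (chartAt (EuclideanSpace ℝ (Fin n)) x).target) :
    DifferentiableAt ℝ (W ∘ (chartAt (EuclideanSpace ℝ (Fin n)) x).symm) u :=
  differentiableAt_of_contDiffOn (hW x) (chartAt (EuclideanSpace ℝ (Fin n)) x).open_target hu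

/-- Needed because the chart attached to a point may jump as the point moves, so continuity is not
visible from a definition in that chart. -/
theorem continuous_of_chart {f : M → ℝ} {g : M → EuclideanSpace ℝ (Fin n) → ℝ}
    (hg : ∀ x, ContinuousOn (g x) (chartAt (EuclideanSpace ℝ (Fin n)) x).target)
    (hfg : ∀ x, ∀ u ∈ (chartAt (EuclideanSpace ℝ (Fin n)) x).target,
      f ((chartAt (EuclideanSpace ℝ (Fin n)) x).symm u) = g x u) : Continuous f := by
  refine continuous_iff_continuousAt.2 fun x ↦ ?_
  set c := chartAt (EuclideanSpace ℝ (Fin n)) x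
  have hx : x ∈ c.source := mem_chart_source _ x
  have h1 : ContinuousAt (g x ∘ c) x :=
    ((hg x).continuousAt (c.open_target.mem_nhds (c.map_source hx))).comp (c.continuousAt hx)
  refine h1.congr ?_
  filter_upwards [c.open_source.mem_nhds hx] with p hp
  rw [Function.comp_apply, ← hfg x _ (c.map_source hp), c.left_inv hp]

variable [IsManifold (𝓡 n) ∞ M] {X W N : M → Ambient n}

theorem meanCurvature_chartAt_symm
    (hX : Manifold.IsSmoothEmbedding (𝓡 n) 𝓘(ℝ, Ambient n) ∞ X) (hW : IsChartSmooth W) {x : M}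
    {u : EuclideanSpace ℝ (Fin n)} (hu : u ∈ (chartAt (EuclideanSpace ℝ (Fin n)) x).target) :
    meanCurvature X W ((chartAt (EuclideanSpace ℝ (Fin n)) x).symm u)
      = meanCurvatureIn X W x u := by
  have hmem : chartAt (EuclideanSpace ℝ (Fin n))
      ((chartAt (EuclideanSpace ℝ (Fin n)) x).symm u)
      ((chartAt (EuclideanSpace ℝ (Fin n)) x).symm u) ∈ (chartAt (EuclideanSpace ℝ (Fin n))
      ((chartAt (EuclideanSpace ℝ (Fin n)) x).symm u)).target := mem_chart_target _ _
  exact (meanCurvatureIn_change hu (mem_chart_source _ _)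
    (IsChartSmooth.differentiableAt (contDiffOn_comp_chartAt_symm hX.contMDiff) hmem)
    (hW.differentiableAt hmem) (linearIndependent_coordDeriv hX.isImmersion hu)).symm

theorem continuousOn_meanCurvatureIn
    (hX : Manifold.IsSmoothEmbedding (𝓡 n) 𝓘(ℝ, Ambient n) ∞ X) (hW : IsChartSmooth W) (x : M) :
    ContinuousOn (meanCurvatureIn X W x) (chartAt (EuclideanSpace ℝ (Fin n)) x).target :=
  (contDiffOn_meanCurvatureIn (X := fun _ ↦ X) (W := fun _ ↦ W) (u := id)
    (contDiffOn_coordDeriv (chartAt (EuclideanSpace ℝ (Fin n)) x).open_target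
      (contDiffOn_comp_chartAt_symm hX.contMDiff x))
    (contDiffOn_coordDeriv (chartAt (EuclideanSpace ℝ (Fin n)) x).open_target (hW x))
    fun _ hu ↦ linearIndependent_coordDeriv hX.isImmersion hu).continuousOn

theorem continuous_meanCurvature
    (hX : Manifold.IsSmoothEmbedding (𝓡 n) 𝓘(ℝ, Ambient n) ∞ X) (hW : IsChartSmooth W) :
    Continuous (meanCurvature X W) :=
  continuous_of_chart (continuousOn_meanCurvatureIn hX hW)
    fun _ _ hu ↦ meanCurvature_chartAt_symm hX hW hu

omit [IsManifold (𝓡 n) ∞ M] in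
-- Linearity in the field, which lets a partition of unity localize the divergence theorem.
theorem meanCurvature_sum {ι : Type*} (I : Finset ι) {V : ι → M → Ambient n}
    (hV : ∀ i, IsChartSmooth (V i)) (p : M) :
    meanCurvature X (fun q ↦ ∑ i ∈ I, V i q) p = ∑ i ∈ I, meanCurvature X (V i) p := by
  have h1 : ∀ k, coordDeriv (fun q ↦ ∑ i ∈ I, V i q) p
      (chartAt (EuclideanSpace ℝ (Fin n)) p p) k
      = ∑ i ∈ I, coordDeriv (V i) p (chartAt (EuclideanSpace ℝ (Fin n)) p p) k := by
    intro k
    have h2 : fderiv ℝ (fun u ↦ ∑ i ∈ I,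
        (V i ∘ (chartAt (EuclideanSpace ℝ (Fin n)) p).symm) u)
        (chartAt (EuclideanSpace ℝ (Fin n)) p p) = _ := fderiv_fun_sum fun i _ ↦
      (hV i).differentiableAt (mem_chart_target _ p)
    change fderiv ℝ (fun u ↦ ∑ i ∈ I, (V i ∘ (chartAt (EuclideanSpace ℝ (Fin n)) p).symm) u)
      (chartAt (EuclideanSpace ℝ (Fin n)) p p) _ = _
    rw [h2, _root_.sum_apply]
    rfl
  have h3 : ∀ k l, sffAt X (fun q ↦ ∑ i ∈ I, V i q) p k l = ∑ i ∈ I, sffAt X (V i) p k l := by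
    intro k l
    simp only [sffAt, sffMatrix, Matrix.of_apply]
    rw [h1, sum_inner]
  simp only [meanCurvature, h3, Finset.mul_sum]
  symm
  rw [Finset.sum_comm]
  exact Finset.sum_congr rfl fun k _ ↦ Finset.sum_comm

omit [IsManifold (𝓡 n) ∞ M] in
theorem meanCurvature_eq_zero_of_eventually {p : M} (h : ∀ᶠ q in 𝓝 p, W q = 0) :
    meanCurvature X W p = 0 := by
  set c := chartAt (EuclideanSpace ℝ (Fin n)) p
  have h1 : W ∘ c.symm =ᶠ[𝓝 (c p)] fun _ ↦ 0 := by
    have h2 : Tendsto c.symm (𝓝 (c p)) (𝓝 p) := by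
      have := c.continuousAt_symm (mem_chart_target _ p)
      rwa [ContinuousAt, c.left_inv (mem_chart_source _ p)] at this
    exact h2.eventually h
  have h3 : ∀ k, coordDeriv W p (c p) k = 0 := by
    intro k
    change fderiv ℝ (W ∘ c.symm) (c p) _ = 0
    rw [h1.fderiv_eq]
    simp
  simp only [meanCurvature, sffAt, sffMatrix, Matrix.of_apply]
  refine Finset.sum_eq_zero fun i _ ↦ Finset.sum_eq_zero fun j _ ↦ ?_
  rw [h3, inner_zero_left, mul_zero]

variable [T2Space M] [CompactSpace M] [MeasurableSpace M] [BorelSpace M]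

/-- **The divergence theorem** on a closed hypersurface, for smooth tangential fields. -/
theorem integral_meanCurvature_tangential
    (hX : Manifold.IsSmoothEmbedding (𝓡 n) 𝓘(ℝ, Ambient n) ∞ X)
    (hN : IsOutwardUnitNormal X N) (hW : IsChartSmooth W) (hWN : ∀ p, inner ℝ (W p) (N p) = 0) :
    ∫ p, meanCurvature X W p ∂(volumeMeasure X) = 0 := by
  -- The pieces remain tangential, and each is supported in one chart.
  let V : M → M → Ambient n := fun x q ↦ chartPartition n M x q • W q
  have hV : ∀ x, IsChartSmooth (V x) := fun x y ↦
    (contDiffOn_comp_chartAt_symm (chartPartition n M x).contMDiff y).smul (hW y)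
  have hsum : W = fun q ↦ ∑ x ∈ chartIndex n M, V x q := by
    funext q
    simp only [V]
    rw [← Finset.sum_smul, sum_chartPartition, one_smul]
  have hN0 : ∀ p, N p ≠ 0 := fun p ↦ by
    rw [← norm_ne_zero_iff, hN.norm_eq_one]
    exact one_ne_zero
  have hmc : ∀ p, meanCurvature X W p = ∑ x ∈ chartIndex n M, meanCurvature X (V x) p := by
    intro p
    conv_lhs => rw [hsum]
    exact meanCurvature_sum _ hV p
  simp only [hmc]
  rw [integral_finsetSum _ fun x _ ↦
    integrable_volumeMeasure hX (continuous_meanCurvature hX (hV x))]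
  refine Finset.sum_eq_zero fun x _ ↦ ?_
  set c := chartAt (EuclideanSpace ℝ (Fin n)) x
  have hsub := chartPartition_isSubordinate n M x
  rw [integral_volumeMeasure_of_support_subset hX (continuous_meanCurvature hX (hV x))
    (isClosed_tsupport _) hsub fun p hp ↦ meanCurvature_eq_zero_of_eventually ?_]
  · rw [← setIntegral_meanCurvatureIn_eq_zero c.open_target
      (contDiffOn_comp_chartAt_symm hX.contMDiff x) (hV x x)
      (fun u hu ↦ linearIndependent_coordDeriv hX.isImmersion hu) hN0
      (fun u hu i ↦ inner_normal_coordDeriv hX.contMDiff hN hu i)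
      (fun p ↦ by simp only [V]; rw [inner_smul_left, hWN, mul_zero])
      (isCompact_image_chartAt (isClosed_tsupport _) hsub) (image_chartAt_subset_target hsub)
      fun u hu huK ↦ by simp only [V]; rw [chartPartition_symm_eq_zero hu huK, zero_smul]]
    refine setIntegral_congr_fun c.open_target.measurableSet fun u hu ↦ ?_
    rw [meanCurvature_chartAt_symm hX (hV x) hu, mul_comm]
  · filter_upwards [(isClosed_tsupport _).isOpen_compl.mem_nhds hp] with q hq
    simp only [V]
    rw [image_eq_zero_of_notMem_tsupport hq, zero_smul]

variable {J : Set ℝ} {X ν : ℝ → M → Ambient n}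

omit [T2Space M] [CompactSpace M] [MeasurableSpace M] [BorelSpace M] [IsManifold (𝓡 n) ∞ M] in
theorem isChartSmooth_slice {X : ℝ → M → Ambient n}
    (hX : ∀ x, ContDiffOn ℝ ∞ (chartRep X x)
      (J ×ˢ (chartAt (EuclideanSpace ℝ (Fin n)) x).target)) {s : ℝ} (hs : s ∈ J) :
    IsChartSmooth (X s) := fun x ↦
  (hX x).comp (contDiff_prodMk_right s).contDiffOn fun _ hu ↦ ⟨hs, hu⟩

omit [T2Space M] [CompactSpace M] [MeasurableSpace M] [BorelSpace M] [IsManifold (𝓡 n) ∞ M] in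
theorem isChartSmooth_deriv (hJ : IsOpen J) {X : ℝ → M → Ambient n}
    (hX : ∀ x, ContDiffOn ℝ ∞ (chartRep X x)
      (J ×ˢ (chartAt (EuclideanSpace ℝ (Fin n)) x).target)) {s : ℝ} (hs : s ∈ J) :
    IsChartSmooth (fun p ↦ deriv (fun t ↦ X t p) s) := fun x ↦ by
  have hΩ := hJ.prod (chartAt (EuclideanSpace ℝ (Fin n)) x).open_target
  refine ((contDiffOn_fderiv_apply (hX x) hΩ (1, 0)).comp
    (contDiff_prodMk_right s).contDiffOn fun u hu ↦ ⟨hs, hu⟩).congr fun u hu ↦ ?_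
  exact (hasDerivAt_slice_left (differentiableAt_of_contDiffOn (hX x) hΩ ⟨hs, hu⟩)).deriv

omit [T2Space M] [CompactSpace M] [MeasurableSpace M] [BorelSpace M] [IsManifold (𝓡 n) ∞ M] in
-- Differentiating `|ν|² = 1` in the parameter shows `δν` tangential, as the divergence theorem
-- requires.
theorem inner_deriv_normal (hJ : IsOpen J)
    (hνs : ∀ x, ContDiffOn ℝ ∞ (chartRep ν x)
      (J ×ˢ (chartAt (EuclideanSpace ℝ (Fin n)) x).target))
    (hν : ∀ s ∈ J, IsOutwardUnitNormal (X s) (ν s)) {s : ℝ} (hs : s ∈ J) (p : M) :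
    inner ℝ (deriv (fun t ↦ ν t p) s) (ν s p) = 0 := by
  have hd : HasDerivAt (fun t ↦ ν t p) (deriv (fun t ↦ ν t p) s) s := by
    have h1 := hasDerivAt_slice_left (differentiableAt_of_contDiffOn (hνs p)
      (hJ.prod (chartAt (EuclideanSpace ℝ (Fin n)) p).open_target)
      (show (s, chartAt (EuclideanSpace ℝ (Fin n)) p p) ∈ _ from ⟨hs, mem_chart_target _ p⟩))
    simp only [chartRep, (chartAt (EuclideanSpace ℝ (Fin n)) p).left_inv
      (mem_chart_source _ p)] at h1
    exact h1.differentiableAt.hasDerivAt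
  have h2 := hd.inner ℝ hd
  have h3 : HasDerivAt (fun t ↦ inner ℝ (ν t p) (ν t p)) (0 : ℝ) s := by
    refine (hasDerivAt_const s (1 : ℝ)).congr_of_eventuallyEq ?_
    filter_upwards [hJ.mem_nhds hs] with t ht
    rw [real_inner_self_eq_norm_sq, (hν t ht).norm_eq_one, one_pow]
  have h4 := h2.unique h3
  rw [real_inner_comm] at h4
  linarith

omit [T2Space M] [CompactSpace M] [MeasurableSpace M] [BorelSpace M] in
theorem variationDensity_chartAt_symm (hJ : IsOpen J) (hX : IsSmoothFamilyOfEmbeddings J X)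
    (hνs : ∀ x, ContDiffOn ℝ ∞ (chartRep ν x)
      (J ×ˢ (chartAt (EuclideanSpace ℝ (Fin n)) x).target)) {s : ℝ} (hs : s ∈ J) {x : M}
    {u : EuclideanSpace ℝ (Fin n)} (hu : u ∈ (chartAt (EuclideanSpace ℝ (Fin n)) x).target) :
    variationDensity X ν s ((chartAt (EuclideanSpace ℝ (Fin n)) x).symm u)
      = variationDensityIn X ν s x u := by
  have hXs := contDiffOn_chartRep hX.contMDiffOn
  have hmem : chartAt (EuclideanSpace ℝ (Fin n))
      ((chartAt (EuclideanSpace ℝ (Fin n)) x).symm u)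
      ((chartAt (EuclideanSpace ℝ (Fin n)) x).symm u) ∈ (chartAt (EuclideanSpace ℝ (Fin n))
      ((chartAt (EuclideanSpace ℝ (Fin n)) x).symm u)).target := mem_chart_target _ _
  refine (variationDensityIn_change hu (mem_chart_source _ _) ?_
    ((isChartSmooth_slice hνs hs).differentiableAt hmem) (fun i j ↦ ?_)
    (linearIndependent_coordDeriv (hX.isSmoothEmbedding s hs).isImmersion hu)).symm
  · filter_upwards [hJ.mem_nhds hs] with t ht
    exact (isChartSmooth_slice hXs ht).differentiableAt hmem
  · exact (hasDerivAt_metricMatrix (hJ.prod (chartAt (EuclideanSpace ℝ (Fin n)) _).open_target)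
      (hXs _) ⟨hs, hmem⟩ i j).differentiableAt

omit [T2Space M] [CompactSpace M] [MeasurableSpace M] [BorelSpace M] in
theorem continuousOn_variationDensityIn (hJ : IsOpen J) (hX : IsSmoothFamilyOfEmbeddings J X)
    (hνs : ∀ x, ContDiffOn ℝ ∞ (chartRep ν x)
      (J ×ˢ (chartAt (EuclideanSpace ℝ (Fin n)) x).target)) {s : ℝ} (hs : s ∈ J) (x : M) :
    ContinuousOn (variationDensityIn X ν s x)
      (chartAt (EuclideanSpace ℝ (Fin n)) x).target := by
  set c := chartAt (EuclideanSpace ℝ (Fin n)) x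
  have hXs := contDiffOn_chartRep hX.contMDiffOn
  have hXe := hX.isSmoothEmbedding s hs
  have hXc : ∀ i, ContDiffOn ℝ ∞ (fun u ↦ coordDeriv (X s) x u i) c.target :=
    contDiffOn_coordDeriv c.open_target (isChartSmooth_slice hXs hs x)
  have hνc : ∀ i, ContDiffOn ℝ ∞ (fun u ↦ coordDeriv (ν s) x u i) c.target :=
    contDiffOn_coordDeriv c.open_target (isChartSmooth_slice hνs hs x)
  have hYc : ∀ i, ContDiffOn ℝ ∞
      (fun u ↦ coordDeriv (fun p ↦ deriv (fun t ↦ X t p) s) x u i) c.target :=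
    contDiffOn_coordDeriv c.open_target (isChartSmooth_deriv hJ hXs hs x)
  have hinv : ∀ i j, ContinuousOn (fun u ↦ (metricMatrix (X s) x u)⁻¹ i j) c.target := fun i j ↦
    (contDiffOn_metricMatrix_inv (X := fun _ ↦ X s) (u := id) hXc
      (fun _ hu ↦ linearIndependent_coordDeriv hXe.isImmersion hu) i j).continuousOn
  have hδ : ∀ i j, ContinuousOn (fun u ↦ deriv (fun t ↦ metricMatrix (X t) x u i j) s)
      c.target := by
    intro i j
    refine ((((hXc i).inner ℝ (hYc j)).add
      ((hYc i).inner ℝ (hXc j))).continuousOn).congr fun u hu ↦ ?_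
    exact (hasDerivAt_metricMatrix (hJ.prod c.open_target) (hXs x) ⟨hs, hu⟩ i j).deriv
  refine continuousOn_finsetSum _ fun i _ ↦ continuousOn_finsetSum _ fun j _ ↦
    ((((continuousOn_meanCurvatureIn hXe (isChartSmooth_slice hνs hs) x).mul (hinv i j)).sub
      (continuousOn_finsetSum _ fun k _ ↦ continuousOn_finsetSum _ fun l _ ↦
        ((hinv i k).mul (hinv j l)).mul ?_)).mul (hδ i j))
  exact ((hνc k).inner ℝ (hXc l)).continuousOn

omit [T2Space M] [CompactSpace M] [MeasurableSpace M] [BorelSpace M] in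
theorem continuous_variationDensity (hJ : IsOpen J) (hX : IsSmoothFamilyOfEmbeddings J X)
    (hνs : ∀ x, ContDiffOn ℝ ∞ (chartRep ν x)
      (J ×ˢ (chartAt (EuclideanSpace ℝ (Fin n)) x).target)) {s : ℝ} (hs : s ∈ J) :
    Continuous (variationDensity X ν s) :=
  continuous_of_chart (continuousOn_variationDensityIn hJ hX hνs hs)
    fun _ _ hu ↦ variationDensity_chartAt_symm hJ hX hνs hs hu

/-- The first variation of the total mean curvature. -/
theorem hasDerivAt_totalMeanCurvature (hJ : IsOpen J) (hX : IsSmoothFamilyOfEmbeddings J X)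
    (hν : ∀ s ∈ J, IsOutwardUnitNormal (X s) (ν s)) {s : ℝ} (hs : s ∈ J) :
    HasDerivAt (fun t ↦ totalMeanCurvature (X t) (ν t))
      ((1 / 2) * ∫ p, variationDensity X ν s p ∂(volumeMeasure (X s))) s := by
  have hXs := contDiffOn_chartRep hX.contMDiffOn
  have hνs := contDiffOn_chartRep_normal hJ hX hν
  have hXe := hX.isSmoothEmbedding s hs
  let δν : M → Ambient n := fun p ↦ deriv (fun t ↦ ν t p) s
  have hδν : IsChartSmooth δν := isChartSmooth_deriv hJ hνs hs
  let Φ : M → ℝ × EuclideanSpace ℝ (Fin n) → ℝ := fun x q ↦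
    meanCurvatureIn (X q.1) (ν q.1) x q.2 * √(metricMatrix (X q.1) x q.2).det
  have hΦ : ∀ x, ContDiffOn ℝ ∞ (Φ x)
      (J ×ˢ (chartAt (EuclideanSpace ℝ (Fin n)) x).target) := by
    intro x
    have hΩ := hJ.prod (chartAt (EuclideanSpace ℝ (Fin n)) x).open_target
    have hli : ∀ q ∈ J ×ˢ (chartAt (EuclideanSpace ℝ (Fin n)) x).target,
        LinearIndependent ℝ (coordDeriv (X q.1) x q.2) := fun q hq ↦
      linearIndependent_coordDeriv (hX.isSmoothEmbedding q.1 hq.1).isImmersion hq.2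
    exact (contDiffOn_meanCurvatureIn (X := fun q : ℝ × EuclideanSpace ℝ (Fin n) ↦ X q.1)
      (W := fun q ↦ ν q.1) (u := fun q ↦ q.2) (contDiffOn_coordDeriv_family hΩ (hXs x))
      (contDiffOn_coordDeriv_family hΩ (hνs x)) hli).mul
      (contDiffOn_sqrt_det_metricMatrix (X := fun q : ℝ × EuclideanSpace ℝ (Fin n) ↦ X q.1)
        (u := fun q ↦ q.2) (contDiffOn_coordDeriv_family hΩ (hXs x)) hli)
  have hder : HasDerivAt (fun t ↦ ∑ x ∈ chartIndex n M,
      ∫ u in (chartAt (EuclideanSpace ℝ (Fin n)) x).target,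
        chartPartition n M x ((chartAt (EuclideanSpace ℝ (Fin n)) x).symm u) * Φ x (t, u))
      (∑ x ∈ chartIndex n M, ∫ u in (chartAt (EuclideanSpace ℝ (Fin n)) x).target,
        chartPartition n M x ((chartAt (EuclideanSpace ℝ (Fin n)) x).symm u)
          * fderiv ℝ (Φ x) (s, u) (1, 0)) s := by
    refine HasDerivAt.fun_sum fun x _ ↦ ?_
    have hsub := chartPartition_isSubordinate n M x
    exact hasDerivAt_setIntegral_mul hJ (chartAt (EuclideanSpace ℝ (Fin n)) x).open_target
      (isCompact_image_chartAt (isClosed_tsupport _) hsub) (image_chartAt_subset_target hsub)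
      ((chartPartition n M x).contMDiff.continuous.comp_continuousOn
        (chartAt (EuclideanSpace ℝ (Fin n)) x).continuousOn_symm)
      (fun u hu huK ↦ chartPartition_symm_eq_zero hu huK) (hΦ x) hs
  have htotal : ∀ t ∈ J, totalMeanCurvature (X t) (ν t) = ∑ x ∈ chartIndex n M,
      ∫ u in (chartAt (EuclideanSpace ℝ (Fin n)) x).target,
        chartPartition n M x ((chartAt (EuclideanSpace ℝ (Fin n)) x).symm u) * Φ x (t, u) := by
    intro t ht
    have hte := hX.isSmoothEmbedding t ht
    have htν : IsChartSmooth (ν t) := isChartSmooth_slice hνs ht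
    rw [totalMeanCurvature, integral_volumeMeasure hte (continuous_meanCurvature hte htν)]
    refine Finset.sum_congr rfl fun x _ ↦ setIntegral_congr_fun
      (chartAt (EuclideanSpace ℝ (Fin n)) x).open_target.measurableSet fun u hu ↦ ?_
    simp only [Φ]
    rw [meanCurvature_chartAt_symm hte htν hu]
    ring
  have hvar := continuous_variationDensity hJ hX hνs hs
  have hdiv := continuous_meanCurvature hXe hδν
  -- The partition does not depend on the parameter, so the local variation formulas reassemble into
  -- one global integral.
  have hval : ∑ x ∈ chartIndex n M, ∫ u in (chartAt (EuclideanSpace ℝ (Fin n)) x).target,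
        chartPartition n M x ((chartAt (EuclideanSpace ℝ (Fin n)) x).symm u)
          * fderiv ℝ (Φ x) (s, u) (1, 0)
      = ∫ p, (1 / 2 * variationDensity X ν s p + meanCurvature (X s) δν p)
          ∂(volumeMeasure (X s)) := by
    have hcont : Continuous fun p ↦ 1 / 2 * variationDensity X ν s p
        + meanCurvature (X s) δν p := (continuous_const.mul hvar).add hdiv
    rw [integral_volumeMeasure hXe hcont]
    refine Finset.sum_congr rfl fun x _ ↦ setIntegral_congr_fun
      (chartAt (EuclideanSpace ℝ (Fin n)) x).open_target.measurableSet fun u hu ↦ ?_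
    have hΩ := hJ.prod (chartAt (EuclideanSpace ℝ (Fin n)) x).open_target
    have h1 := hasDerivAt_slice_left (differentiableAt_of_contDiffOn (hΦ x) hΩ ⟨hs, hu⟩)
    have h2 := hasDerivAt_meanCurvatureIn_mul_sqrt_det hΩ (hXs x) (hνs x) ⟨hs, hu⟩
      (linearIndependent_coordDeriv hXe.isImmersion hu) (hν s hs).norm_eq_one
      fun u' hu' i ↦ inner_normal_coordDeriv hXe.contMDiff (hν s hs) hu'.2 i
    rw [h1.unique h2, variationDensity_chartAt_symm hJ hX hνs hs hu,
      meanCurvature_chartAt_symm hXe hδν hu]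
    ring
  have hfinal : ∫ p, (1 / 2 * variationDensity X ν s p + meanCurvature (X s) δν p)
      ∂(volumeMeasure (X s)) = 1 / 2 * ∫ p, variationDensity X ν s p ∂(volumeMeasure (X s)) := by
    rw [integral_add ((integrable_volumeMeasure hXe hvar).const_mul _)
      (integrable_volumeMeasure hXe hdiv), integral_const_mul,
      integral_meanCurvature_tangential hXe (hν s hs) hδν
        (inner_deriv_normal hJ hνs hν hs), add_zero]
  rw [hval, hfinal] at hder
  refine hder.congr_of_eventuallyEq ?_
  filter_upwards [hJ.mem_nhds hs] with t ht using htotal t ht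

omit [T2Space M] [CompactSpace M] [MeasurableSpace M] [BorelSpace M] in
-- All parameters near `s` induce the same metric matrix at `p`, so `δσ = 0`.
theorem variationDensity_eq_zero_of_isIsometric (hJ : IsOpen J)
    (hX : IsSmoothFamilyOfEmbeddings J X)
    {g : Bundle.ContMDiffRiemannianMetric (𝓡 n) ∞ (EuclideanSpace ℝ (Fin n))
      (fun p : M ↦ TangentSpace (𝓡 n) p)} (hg : ∀ s ∈ J, IsIsometric g (X s)) {s : ℝ}
    (hs : s ∈ J) (p : M) : variationDensity X ν s p = 0 := by
  have h0 : ∀ i j, metricVariation X s p i j = 0 := by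
    intro i j
    refine ((hasDerivAt_const s (metricAt (X s) p i j)).congr_of_eventuallyEq ?_).deriv
    filter_upwards [hJ.mem_nhds hs] with t ht
    simp only [metricAt, metricMatrix, Matrix.of_apply]
    rw [coordDeriv_eq_mfderiv (hX.isSmoothEmbedding t ht).contMDiff (mem_chart_target _ p),
      coordDeriv_eq_mfderiv (hX.isSmoothEmbedding t ht).contMDiff (mem_chart_target _ p),
      coordDeriv_eq_mfderiv (hX.isSmoothEmbedding s hs).contMDiff (mem_chart_target _ p),
      coordDeriv_eq_mfderiv (hX.isSmoothEmbedding s hs).contMDiff (mem_chart_target _ p)]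
    exact (hg t ht _ _ _).trans (hg s hs _ _ _).symm
  simp only [variationDensity, h0, mul_zero, Finset.sum_const_zero]

end Global

end Hypersurface

end

/-! ### Conclusion: the variation formula and the invariance under isometric deformation. -/

theorem mainTheorem10 {n : ℕ} {M : Type*} [TopologicalSpace M]
    [ChartedSpace (EuclideanSpace ℝ (Fin n)) M] [IsManifold (𝓡 n) ∞ M]
    [T2Space M] [CompactSpace M] [MeasurableSpace M] [BorelSpace M]
    (J : Set ℝ) (hJ : IsOpen J) (hJ' : J.OrdConnected)
    (X ν : ℝ → M → Hypersurface.Ambient n)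
    (hX : Hypersurface.IsSmoothFamilyOfEmbeddings J X)
    (hν : ∀ s ∈ J, Hypersurface.IsOutwardUnitNormal (X s) (ν s)) :
    (∀ s ∈ J,
      Integrable (Hypersurface.meanCurvature (X s) (ν s)) (Hypersurface.volumeMeasure (X s)) ∧
      Integrable (Hypersurface.variationDensity X ν s) (Hypersurface.volumeMeasure (X s)) ∧
      HasDerivAt (fun t ↦ Hypersurface.totalMeanCurvature (X t) (ν t))
        ((1 / 2) * ∫ p, Hypersurface.variationDensity X ν s p
          ∂(Hypersurface.volumeMeasure (X s))) s) ∧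
    (∀ g : Bundle.ContMDiffRiemannianMetric (𝓡 n) ∞ (EuclideanSpace ℝ (Fin n))
        (fun p : M ↦ TangentSpace (𝓡 n) p),
      (∀ s ∈ J, Hypersurface.IsIsometric g (X s)) →
      ∀ s ∈ J, ∀ t ∈ J, Hypersurface.totalMeanCurvature (X s) (ν s)
        = Hypersurface.totalMeanCurvature (X t) (ν t)) := by
  have hνs := Hypersurface.contDiffOn_chartRep_normal hJ hX hν
  refine ⟨fun s hs ↦ ⟨?_, ?_, Hypersurface.hasDerivAt_totalMeanCurvature hJ hX hν hs⟩, ?_⟩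
  · exact Hypersurface.integrable_volumeMeasure (hX.isSmoothEmbedding s hs)
      (Hypersurface.continuous_meanCurvature (hX.isSmoothEmbedding s hs)
        (Hypersurface.isChartSmooth_slice hνs hs))
  · exact Hypersurface.integrable_volumeMeasure (hX.isSmoothEmbedding s hs)
      (Hypersurface.continuous_variationDensity hJ hX hνs hs)
  · intro g hg s hs t ht
    have hderiv : ∀ r ∈ J, HasDerivAt
        (fun t ↦ Hypersurface.totalMeanCurvature (X t) (ν t)) 0 r := by
      intro r hr
      have h1 := Hypersurface.hasDerivAt_totalMeanCurvature hJ hX hν hr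
      simp only [Hypersurface.variationDensity_eq_zero_of_isIsometric hJ hX hg hr,
        integral_zero, mul_zero] at h1
      exact h1
    exact hJ.is_const_of_deriv_eq_zero hJ'.isPreconnected
      (fun r hr ↦ (hderiv r hr).differentiableAt.differentiableWithinAt)
      (fun r hr ↦ (hderiv r hr).deriv) hs ht
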